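/- Let $N\ge 1$ be an integer, let $p\in[1,\infty)$, let $I=(0,1)$, and let $(\rho_t)_{t\in I}\subset L^1_{\rm loc}(\mathbb R^N)$ be a family of non-negative functions. For $u\in L^p(\mathbb R^N)$ and $t\in I$ let $$\mathscr F_{t,p}(u)=\int_{\mathbb R^N}\int_{\mathbb R^N}\frac{|u(x)-u(y)|^p}{|x-y|^p}\,\rho_t(x-y)\,dx\,dy\in[0,\infty].$$ Let $S^p(\mathbb R^N)=W^{1,p}(\mathbb R^N)$ if $p>1$ and $S^1(\mathbb R^N)=BV(\mathbb R^N)$, and let $Du$ be the distributional gradient of $u\in S^p(\mathbb R^N)$ (a finite $\mathbb R^N$-valued Radon measure if $p=1$). For a finite non-negative Radon measure $\mu$ on the unit sphere $\mathbb S^{N-1}=\{x\in\mathbb R^N:|x|=1\}$ and $u\in S^p(\mathbb R^N)$ let $$\mathscr D_p^\mu(u)=\int_{\mathbb S^{N-1}}\|\sigma\cdot Du\|_{L^p}^p\,d\mu(\sigma),$$ where $\|\sigma\cdot Du\|_{L^p}^p=\int_{\mathbb R^N}|\sigma\cdot Du(x)|^p\,dx$ if $p>1$, and $\|\sigma\cdot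 Du\|_{L^1}=|\sigma\cdot Du|(\mathbb R^N)$ is the total variation of the measure $\sigma\cdot Du$ if $p=1$. The following are equivalent. (A) There exist a sequence $(t_k)_{k\in\mathbb N}\subset I$ with $t_k\to0$ and a number $\alpha\ge0$ such that $$\sup_{R>0}\,\limsup_{k\to\infty}\,R^p\int_{\mathbb R^N}\frac{\rho_{t_k}(z)}{R^p+|z|^p}\,dz<\infty$$ and $\rho_{t_k}\mathscr L^N\overset{\star}{\rightharpoonup}\alpha\delta_0$ as $k\to\infty$, that is, $\int_{\mathbb R^N} f\rho_{t_k}\,dz\to\alpha f(0)$ for every continuous compactly supported $f\colon\mathbb R^N\to\mathbb R$. (B) There exist a sequence $(t_k)_{k\in\mathbb N}\subset I$ with $t_k\to0$ and a finite non-negative Radon measure $\mu$ on $\mathbb S^{N-1}$ such that: (i) if $u\in S^p(\mathbb R^N)$, then $\limsup_{k\to\infty}\mathscr F_{t_k,p}(u)\le\mathscr D_p^\mu(u)$; (ii) if $(u_k)_{k\in\mathbb N}\subset L^p(\mathbb R^N)$ converges in $L^p(\mathbb R^N)$ to some $u\in S^p(\mathbb R^N)$, then $\liminf_{k\to\infty}\mathscr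 F_{t_k,p}(u_k)\ge\mathscr D_p^\mu(u)$. The sequences in (A) and (B) need not be the same. -/

import Mathlib

open MeasureTheory Filter Topology Set
open scoped ENNReal NNReal ContDiff

noncomputable section

/-- The Euclidean space of dimension `N`. -/
abbrev RN (N : ℕ) : Type := EuclideanSpace ℝ (Fin N)

/-- The unit sphere of `RN N`. -/
abbrev Sph (N : ℕ) : Type := Metric.sphere (0 : RN N) 1

/-- `g` is the weak (distributional) gradient of `u`, both being locally integrable:
`∫ u ∇φ = - ∫ φ g` (an identity between vectors) for every smooth compactly supported `φ`. -/
def IsWeakGradient {N : ℕ} (u : RN N → ℝ) (g : RN N → RN N) : Prop :=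
  LocallyIntegrable u volume ∧ LocallyIntegrable g volume ∧
    ∀ φ : RN N → ℝ, ContDiff ℝ ∞ φ → HasCompactSupport φ →
      ∫ x, u x • gradient φ x = - ∫ x, φ x • g x

/-- The finite vector-valued Borel measure `D` is the distributional gradient of the locally
integrable function `u`: `∫ u ∇φ = - ∫ φ dD` for every smooth compactly supported `φ`. -/
def IsGradientMeasure {N : ℕ} (u : RN N → ℝ) (D : VectorMeasure (RN N) (RN N)) : Prop :=
  LocallyIntegrable u volume ∧ D.variation univ < ⊤ ∧
    ∀ φ : RN N → ℝ, ContDiff ℝ ∞ φ → HasCompactSupport φ →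
      ∫ x, u x • gradient φ x = - D.integral φ (ContinuousLinearMap.lsmul ℝ ℝ)

theorem IsWeakGradient.ae_eq {N : ℕ} {u : RN N → ℝ} {g g' : RN N → RN N}
    (h : IsWeakGradient u g) (h' : IsWeakGradient u g') : g =ᵐ[volume] g' :=
  ae_eq_of_integral_contDiff_smul_eq h.2.1 h'.2.1 fun φ hφ hc =>
    neg_injective ((h.2.2 φ hφ hc).symm.trans (h'.2.2 φ hφ hc))

theorem IsGradientMeasure.eq {N : ℕ} {u : RN N → ℝ} {D D' : VectorMeasure (RN N) (RN N)}
    (h : IsGradientMeasure u D) (h' : IsGradientMeasure u D') : D = D' := by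
  have hD : IsFiniteMeasure D.variation := ⟨h.2.1⟩
  have hD' : IsFiniteMeasure D'.variation := ⟨h'.2.1⟩
  have hK : ∀ K : Set (RN N), IsCompact K → D K = D' K := by
    intro K hKc
    have hφ : ∀ n : ℕ, ∃ φ : RN N → ℝ, ContDiff ℝ ∞ φ ∧ (∀ x, φ x ∈ Icc (0 : ℝ) 1) ∧
        Function.support φ = Metric.thickening (1 / ((n : ℝ) + 1)) K ∧ ∀ x ∈ K, φ x = 1 := by
      intro n
      obtain ⟨f, hf, hr, hs, h1⟩ := exists_contMDiff_support_eq_eq_one_iff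
        (modelWithCornersSelf ℝ (RN N)) (n := (⊤ : ℕ∞))
        (Metric.isOpen_thickening (δ := 1 / ((n : ℝ) + 1)) (E := K)) hKc.isClosed
        (Metric.self_subset_thickening (by positivity) K)
      exact ⟨f, hf.contDiff, fun x => hr (mem_range_self x), hs, fun x hx => (h1 x).1 hx⟩
    choose φ hφs hφr hφsupp hφ1 using hφ
    have hcs : ∀ n, HasCompactSupport (φ n) := by
      intro n
      refine HasCompactSupport.of_support_subset_isCompact (hKc.cthickening (r := 1 / ((n : ℝ) + 1))) ?_
      rw [hφsupp]
      exact Metric.thickening_subset_cthickening _ _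
    have hpt : ∀ x, Tendsto (fun n => φ n x) atTop (𝓝 (K.indicator (fun _ => (1 : ℝ)) x)) := by
      intro x
      by_cases hx : x ∈ K
      · simp [hx, hφ1 _ x hx]
      · rw [indicator_of_notMem hx]
        refine tendsto_const_nhds.congr' ?_
        have hcl : x ∉ closure K := by rwa [hKc.isClosed.closure_eq]
        rw [Metric.closure_eq_iInter_thickening] at hcl
        simp only [mem_iInter, not_forall] at hcl
        obtain ⟨δ, hδ, hxδ⟩ := hcl
        obtain ⟨n0, hn0⟩ := exists_nat_one_div_lt hδ
        filter_upwards [eventually_ge_atTop n0] with n hn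
        by_contra hne
        have hmem : x ∈ Function.support (φ n) := fun h0 => hne h0.symm
        rw [hφsupp] at hmem
        refine hxδ (Metric.thickening_mono ?_ K hmem)
        exact (Nat.one_div_le_one_div hn).trans hn0.le
    have key : ∀ W : VectorMeasure (RN N) (RN N), IsFiniteMeasure W.variation →
        Tendsto (fun n => W.integral (φ n) (ContinuousLinearMap.lsmul ℝ ℝ)) atTop
          (𝓝 (W.integral (K.indicator (fun _ => (1 : ℝ))) (ContinuousLinearMap.lsmul ℝ ℝ))) := by
      intro W hW
      refine VectorMeasure.tendsto_integral_of_dominated_convergence (fun _ => 1) ?_ ?_ ?_ ?_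
      · exact fun n => (hφs n).continuous.aestronglyMeasurable
      · exact integrable_const _
      · refine fun n => Eventually.of_forall fun x => ?_
        rw [Real.norm_eq_abs, abs_le]
        exact ⟨by linarith [(hφr n x).1], (hφr n x).2⟩
      · exact Eventually.of_forall hpt
    have hval : ∀ W : VectorMeasure (RN N) (RN N), IsFiniteMeasure W.variation →
        W.integral (K.indicator (fun _ => (1 : ℝ))) (ContinuousLinearMap.lsmul ℝ ℝ) = W K := by
      intro W hW
      rw [VectorMeasure.integral, setToFun_indicator_const _ hKc.measurableSet (measure_ne_top _ _)]
      change (1 : ℝ) • W K = W K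
      exact one_smul ℝ _
    rw [← hval D hD, ← hval D' hD']
    refine tendsto_nhds_unique (key D hD) ((key D' hD').congr fun n => ?_)
    exact neg_injective ((h'.2.2 _ (hφs n) (hcs n)).symm.trans (h.2.2 _ (hφs n) (hcs n)))
  have hC : ∀ C : Set (RN N), IsClosed C → D C = D' C := by
    intro C hCc
    have hu : ⋃ n : ℕ, C ∩ Metric.closedBall 0 (n : ℝ) = C := by
      rw [← inter_iUnion, Metric.iUnion_closedBall_nat, inter_univ]
    have hm : Monotone fun n : ℕ => C ∩ Metric.closedBall (0 : RN N) (n : ℝ) := fun i j hij =>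
      inter_subset_inter_right _ (Metric.closedBall_subset_closedBall (by exact_mod_cast hij))
    have hms : ∀ n : ℕ, MeasurableSet (C ∩ Metric.closedBall (0 : RN N) (n : ℝ)) := fun n =>
      (hCc.inter Metric.isClosed_closedBall).measurableSet
    have h1 := VectorMeasure.tendsto_vectorMeasure_iUnion_atTop_nat (v := D) hm hms
    have h2 := VectorMeasure.tendsto_vectorMeasure_iUnion_atTop_nat (v := D') hm hms
    rw [hu] at h1 h2
    exact tendsto_nhds_unique h1 (h2.congr fun n =>
      (hK _ ((isCompact_closedBall _ _).inter_left hCc)).symm)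
  exact VectorMeasure.ext_of_generateFrom {C | IsClosed C} (fun s hs => hC s hs)
    (by rw [BorelSpace.measurable_eq (α := RN N), borel_eq_generateFrom_isClosed])
    isPiSystem_isClosed (hC _ isClosed_univ)

/-- The weak gradient of `u` (unique almost everywhere), and `0` if there is none. -/
def weakGradient {N : ℕ} (u : RN N → ℝ) : RN N → RN N :=
  open scoped Classical in
  if h : ∃ g, IsWeakGradient u g then h.choose else 0

/-- The distributional gradient of `u` as a finite vector measure (unique), and `0` if there is
none. -/
def gradientMeasure {N : ℕ} (u : RN N → ℝ) : VectorMeasure (RN N) (RN N) :=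
  open scoped Classical in
  if h : ∃ D, IsGradientMeasure u D then h.choose else 0

theorem IsWeakGradient.weakGradient_ae_eq {N : ℕ} {u : RN N → ℝ} {g : RN N → RN N}
    (h : IsWeakGradient u g) : weakGradient u =ᵐ[volume] g := by
  have hex : ∃ g, IsWeakGradient u g := ⟨g, h⟩
  rw [weakGradient, dif_pos hex]
  exact hex.choose_spec.ae_eq h

theorem IsGradientMeasure.gradientMeasure_eq {N : ℕ} {u : RN N → ℝ}
    {D : VectorMeasure (RN N) (RN N)} (h : IsGradientMeasure u D) : gradientMeasure u = D := by
  have hex : ∃ D, IsGradientMeasure u D := ⟨D, h⟩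
  rw [gradientMeasure, dif_pos hex]
  exact hex.choose_spec.eq h

/-- The Sobolev space `W^{1,p}`. -/
def MemW1p {N : ℕ} (p : ℝ) (u : RN N → ℝ) : Prop :=
  MemLp u (ENNReal.ofReal p) volume ∧
    ∃ g, IsWeakGradient u g ∧ MemLp g (ENNReal.ofReal p) volume

/-- The space `BV` of functions of bounded variation. -/
def MemBV {N : ℕ} (u : RN N → ℝ) : Prop :=
  MemLp u 1 volume ∧ ∃ D, IsGradientMeasure u D

/-- The space that is `BV` for `p = 1` and `W^{1,p}` for `p > 1`. -/
def MemS {N : ℕ} (p : ℝ) (u : RN N → ℝ) : Prop :=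
  (p = 1 ∧ MemBV u) ∨ (1 < p ∧ MemW1p p u)

/-- The scalar component `σ · D` of a vector measure `D`. -/
def dotMeasure {N : ℕ} (σ : RN N) (D : VectorMeasure (RN N) (RN N)) : SignedMeasure (RN N) :=
  D.mapRange (innerSL ℝ σ).toLinearMap.toAddMonoidHom (innerSL ℝ σ).continuous

/-- `‖σ · Du‖_p^p`: the total variation `|σ · Du|(ℝ^N)` for `p = 1`, and the integral
`∫ |σ · Du|^p` for `p > 1`. -/
def dirNormPow {N : ℕ} (p : ℝ) (u : RN N → ℝ) (σ : RN N) : ℝ≥0∞ :=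
  open scoped Classical in
  if p = 1 then (dotMeasure σ (gradientMeasure u)).totalVariation univ
  else ∫⁻ x, ENNReal.ofReal (|inner ℝ σ (weakGradient u x)| ^ p)

/-- The anisotropic Dirichlet energy `D_p^μ(u) = ∫ ‖σ · Du‖_p^p dμ(σ)`. -/
def dirichletEnergy {N : ℕ} (p : ℝ) (μ : Measure (Sph N)) (u : RN N → ℝ) : ℝ≥0∞ :=
  ∫⁻ σ, dirNormPow p u (σ : RN N) ∂μ

/-- The nonlocal energy with kernel `κ`:
`∫∫ |u(x) - u(y)|^p / |x - y|^p κ(x - y) dx dy`. -/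
def bbmEnergy {N : ℕ} (p : ℝ) (κ : RN N → ℝ) (u : RN N → ℝ) : ℝ≥0∞ :=
  ∫⁻ y, ∫⁻ x, ENNReal.ofReal (|u x - u y| ^ p / ‖x - y‖ ^ p * κ (x - y))

/-- The measure `κ ℒ^N`, for a nonnegative `κ`. -/
def kernelMeasure {N : ℕ} (κ : RN N → ℝ) : Measure (RN N) :=
  volume.withDensity fun z => ENNReal.ofReal (κ z)

/-- Local weak-star convergence of nonnegative locally finite measures. -/
def WeakStarTendsto {N : ℕ} (ν : ℕ → Measure (RN N)) (ν' : Measure (RN N)) : Prop :=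
  ∀ f : RN N → ℝ, Continuous f → HasCompactSupport f →
    Tendsto (fun k => ∫ z, f z ∂(ν k)) atTop (𝓝 (∫ z, f z ∂ν'))

/-- A sequence in `I = (0,1)` that converges to `0`. -/
def IsInfinitesimal (t : ℕ → ℝ) : Prop :=
  (∀ k, t k ∈ Ioo (0 : ℝ) 1) ∧ Tendsto t atTop (𝓝 0)

end

noncomputable section

/-! Write `d(z)` for `diffNorm p u z` and `ν_k` for the kernel measure of `ρ_{t_k}`. By
`bbmEnergy_eq` the energy is the integral of `h(z) = (d(z)/|z|)^p` against `ν_k`. Everything rests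
on the subadditivity of `d` (`diffNorm_add_le`), hence `d(nz) ≤ n d(z)`: a quotient at a small
displacement dominates the one at any integer multiple. For `u` in the Sobolev or BV space, duality
with test functions shows that `‖σ · Du‖_p` is the least `M` with `d(sσ) ≤ sM` for all `s > 0`
(`MemS.diffNorm_smul_le`, `MemS.dirNormPow_le`). This treats `p = 1` and `p > 1` uniformly, without
approximating `u`.

From (A) to (B): weak-star convergence removes the mass of every annulus and makes the mass of the
unit ball converge to `α`. The directions `z/|z|` of points of the ball have distributions on the
compact sphere, and a subsequence of these converges weakly to `μ`. For the upper bound, `h(z)` is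
at most the directional norm in the ball, the annuli are negligible, and the tail condition makes
the rest `O(R^{-p})` (`limsup_bbmEnergy_le`). For the lower bound, an integer multiple of a tiny `z`
reaches the fixed scale `δ` up to an error less than `|z|`, so the quotient of `u_k` at `z` is
bounded below by that of `u` at `δσ` (`rpow_le_diffNorm_div_rpow`). One lets `k → ∞`, then `δ → 0`
with Fatou's lemma.

From (B) to (A): for a fixed bump, both energies scale in the same way under dilation, so the
integrals of `h(z/R)` against `ν_k` have the same finite limit `E` for every `R`. Since `h(z) ≥
c/(1+|z|^p)`, this bounds the tail integrals by `E/c`. Since `h(z) - h(nz)` is nonnegative and, for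
large `n`, bounded below on a given annulus, equality of the limits at the scales `1` and `1/n`
sends the mass of the annulus to zero (`tendsto_measure_annulus`). The mass of the unit ball stays
bounded, and a subsequence along which it converges supplies `α`. -/

/-- The `L^p` norm of the difference between `u` and its translate. -/
def diffNorm {N : ℕ} (p : ℝ) (u : RN N → ℝ) (z : RN N) : ℝ :=
  (eLpNorm (fun x => u (x + z) - u x) (ENNReal.ofReal p) volume).toReal

/-! ### Translation differences and the energy as an integral over displacements -/

section diffNorm

variable {N : ℕ} {p : ℝ} {u v : RN N → ℝ}

theorem one_le_ofReal_of_one_le (hp : 1 ≤ p) : 1 ≤ ENNReal.ofReal p := by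
  simpa using ENNReal.ofReal_le_ofReal hp

theorem MeasureTheory.MemLp.comp_add_right_RN {q : ℝ≥0∞} (hu : MemLp u q volume) (z : RN N) :
    MemLp (fun x => u (x + z)) q volume :=
  hu.comp_measurePreserving (measurePreserving_add_right volume z)

theorem eLpNorm_comp_add_right {q : ℝ≥0∞} (hu : AEStronglyMeasurable u volume) (z : RN N) :
    eLpNorm (fun x => u (x + z)) q volume = eLpNorm u q volume :=
  eLpNorm_comp_measurePreserving hu (measurePreserving_add_right volume z)

theorem memLp_diff {q : ℝ≥0∞} (hu : MemLp u q volume) (z : RN N) :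
    MemLp (fun x => u (x + z) - u x) q volume :=
  (hu.comp_add_right_RN z).sub hu

theorem diffNorm_nonneg (z : RN N) : 0 ≤ diffNorm p u z := ENNReal.toReal_nonneg

theorem ofReal_diffNorm (hu : MemLp u (ENNReal.ofReal p) volume) (z : RN N) :
    ENNReal.ofReal (diffNorm p u z) =
      eLpNorm (fun x => u (x + z) - u x) (ENNReal.ofReal p) volume :=
  ENNReal.ofReal_toReal (memLp_diff hu z).2.ne

@[simp]
theorem diffNorm_zero : diffNorm p u 0 = 0 := by simp [diffNorm]

/-- Split the difference at `u(x + w)`: one part is a translate by `w` of the difference along `z`,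
and translations preserve the norm. -/
theorem diffNorm_add_le (hp : 1 ≤ p) (hu : MemLp u (ENNReal.ofReal p) volume) (z w : RN N) :
    diffNorm p u (z + w) ≤ diffNorm p u z + diffNorm p u w := by
  have h1 := (memLp_diff hu z).comp_add_right_RN w
  rw [diffNorm, diffNorm, diffNorm, ← ENNReal.toReal_add (memLp_diff hu z).2.ne
    (memLp_diff hu w).2.ne]
  refine ENNReal.toReal_mono
    (ENNReal.add_ne_top.2 ⟨(memLp_diff hu z).2.ne, (memLp_diff hu w).2.ne⟩) ?_
  rw [← eLpNorm_comp_add_right (memLp_diff hu z).1 w]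
  refine le_trans (le_of_eq ?_) (eLpNorm_add_le h1.1 (memLp_diff hu w).1
    (one_le_ofReal_of_one_le hp))
  congr 1
  ext x
  simp [add_comm z w, add_assoc]

theorem diffNorm_nsmul_le (hp : 1 ≤ p) (hu : MemLp u (ENNReal.ofReal p) volume) (n : ℕ)
    (z : RN N) : diffNorm p u (n • z) ≤ n * diffNorm p u z := by
  induction n with
  | zero => simp
  | succ n ih =>
    rw [succ_nsmul]
    refine (diffNorm_add_le hp hu _ _).trans ?_
    push_cast
    linarith

theorem diffNorm_le_add (hp : 1 ≤ p) (hu : MemLp u (ENNReal.ofReal p) volume)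
    (hv : MemLp v (ENNReal.ofReal p) volume) (z : RN N) :
    diffNorm p u z ≤ diffNorm p v z +
      2 * (eLpNorm (v - u) (ENNReal.ofReal p) volume).toReal := by
  have hw : MemLp (u - v) (ENNReal.ofReal p) volume := hu.sub hv
  rw [eLpNorm_sub_comm, two_mul, ← add_assoc, diffNorm, diffNorm,
    ← ENNReal.toReal_add (memLp_diff hv z).2.ne hw.2.ne,
    ← ENNReal.toReal_add (ENNReal.add_ne_top.2 ⟨(memLp_diff hv z).2.ne, hw.2.ne⟩) hw.2.ne]
  refine ENNReal.toReal_mono (by simp [(memLp_diff hv z).2.ne, hw.2.ne]) ?_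
  have h1 := hw.comp_add_right_RN z
  have e : (fun x => u (x + z) - u x) =
      ((fun x => v (x + z) - v x) + fun x => (u - v) (x + z)) - (u - v) := by
    ext x; simp
  rw [e]
  refine (eLpNorm_sub_le ((memLp_diff hv z).1.add h1.1) hw.1 (one_le_ofReal_of_one_le hp)).trans ?_
  gcongr
  refine (eLpNorm_add_le (memLp_diff hv z).1 h1.1 (one_le_ofReal_of_one_le hp)).trans ?_
  rw [eLpNorm_comp_add_right hw.1]

theorem diffNorm_le_two_mul (hp : 1 ≤ p) (hu : MemLp u (ENNReal.ofReal p) volume) (z : RN N) :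
    diffNorm p u z ≤ 2 * (eLpNorm u (ENNReal.ofReal p) volume).toReal := by
  have := diffNorm_le_add hp hu (v := 0) MemLp.zero' z
  simpa [diffNorm] using this

theorem ofReal_diffNorm_rpow (hp : 1 ≤ p) (hu : MemLp u (ENNReal.ofReal p) volume) (z : RN N) :
    ENNReal.ofReal (diffNorm p u z ^ p) = ∫⁻ x, ENNReal.ofReal (|u (x + z) - u x| ^ p) := by
  have hp0 : 0 < p := by linarith
  rw [← ENNReal.ofReal_rpow_of_nonneg (diffNorm_nonneg z) hp0.le, ofReal_diffNorm hu,
    eLpNorm_eq_lintegral_rpow_enorm_toReal (by simpa using hp0) ENNReal.ofReal_ne_top,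
    ENNReal.toReal_ofReal hp0.le, ← ENNReal.rpow_mul, one_div, inv_mul_cancel₀ hp0.ne',
    ENNReal.rpow_one]
  refine lintegral_congr fun x => ?_
  rw [← ENNReal.ofReal_rpow_of_nonneg (abs_nonneg _) hp0.le, Real.enorm_eq_ofReal_abs]

/-- Substitute `x = y + z`, then integrate over `y` first by Tonelli. At `z = 0` both integrands
vanish by the convention for division by zero, so no point has to be excluded. -/
theorem bbmEnergy_eq (hp : 1 ≤ p) (hu : MemLp u (ENNReal.ofReal p) volume) {κ : RN N → ℝ}
    (hκ : AEMeasurable κ volume) :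
    bbmEnergy p κ u = ∫⁻ z, ENNReal.ofReal ((diffNorm p u z / ‖z‖) ^ p) ∂(kernelMeasure κ) := by
  have hp0 : 0 < p := by linarith
  have hshift : bbmEnergy p κ u = ∫⁻ y, ∫⁻ z,
      ENNReal.ofReal (|u (y + z) - u y| ^ p / ‖z‖ ^ p * κ z) := by
    refine lintegral_congr fun y => ?_
    rw [← lintegral_add_left_eq_self _ y]
    simp
  have hum : AEMeasurable (fun q : RN N × RN N => u (q.1 + q.2)) (volume.prod volume) :=
    hu.1.aemeasurable.comp_quasiMeasurePreserving
      (quasiMeasurePreserving_add volume volume)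
  have hum' : AEMeasurable (fun q : RN N × RN N => u q.1) (volume.prod volume) :=
    hu.1.aemeasurable.comp_quasiMeasurePreserving Measure.quasiMeasurePreserving_fst
  have hκm : AEMeasurable (fun q : RN N × RN N => κ q.2) (volume.prod volume) :=
    hκ.comp_quasiMeasurePreserving Measure.quasiMeasurePreserving_snd
  have hm : AEMeasurable (fun q : RN N × RN N =>
      ENNReal.ofReal (|u (q.1 + q.2) - u q.1| ^ p / ‖q.2‖ ^ p * κ q.2)) (volume.prod volume) := by
    have h1 : AEMeasurable (fun q : RN N × RN N => |u (q.1 + q.2) - u q.1|)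
        (volume.prod volume) := (hum.sub hum').norm
    refine (((h1.pow_const p).div ?_).mul hκm).ennreal_ofReal
    exact (measurable_snd.norm.pow_const p).aemeasurable
  rw [hshift, lintegral_lintegral_swap hm, kernelMeasure]
  have hpos : ∀ z : RN N, ∫⁻ y, ENNReal.ofReal (|u (y + z) - u y| ^ p / ‖z‖ ^ p * κ z) =
      ENNReal.ofReal (κ z) * ENNReal.ofReal ((diffNorm p u z / ‖z‖) ^ p) := by
    intro z
    have : ∀ y, ENNReal.ofReal (|u (y + z) - u y| ^ p / ‖z‖ ^ p * κ z) =
        ENNReal.ofReal (|u (y + z) - u y| ^ p) * ENNReal.ofReal (κ z / ‖z‖ ^ p) := fun y => by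
      rw [← ENNReal.ofReal_mul (by positivity)]
      congr 1
      ring
    rw [lintegral_congr this, lintegral_mul_const', ← ofReal_diffNorm_rpow hp hu,
      Real.div_rpow (diffNorm_nonneg z) (norm_nonneg z), 
      ← ENNReal.ofReal_mul (Real.rpow_nonneg (diffNorm_nonneg z) p), mul_comm (ENNReal.ofReal (κ z)),
      ← ENNReal.ofReal_mul (div_nonneg (Real.rpow_nonneg (diffNorm_nonneg z) p) (by positivity))]
    · congr 1; ring
    · exact ENNReal.ofReal_ne_top
  rw [lintegral_congr hpos, lintegral_withDensity_eq_lintegral_mul_non_measurable₀]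
  · rfl
  · exact hκ.ennreal_ofReal
  · exact Eventually.of_forall fun _ => ENNReal.ofReal_lt_top

end diffNorm


/-! ### Integration of scalar functions against vector measures -/

section VectorIntegral

variable {X F G : Type*} [MeasurableSpace X]
  [NormedAddCommGroup F] [NormedSpace ℝ F] [NormedAddCommGroup G] [NormedSpace ℝ G]

omit [NormedSpace ℝ G] in
/-- Two additive functionals that satisfy bounded convergence and agree on multiples of indicators
agree on bounded measurable functions. -/
theorem functional_eq_of_eq_indicator {I J : (X → ℝ) → G}
    (hind : ∀ (c : ℝ) (s : Set X), MeasurableSet s →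
      I (s.indicator fun _ => c) = J (s.indicator fun _ => c))
    (hI : ∀ f g : SimpleFunc X ℝ, I (f + g) = I f + I g)
    (hJ : ∀ f g : SimpleFunc X ℝ, J (f + g) = J f + J g)
    (hIl : ∀ (fs : ℕ → SimpleFunc X ℝ) (f : X → ℝ) (C : ℝ), (∀ n x, ‖fs n x‖ ≤ C) →
      (∀ x, Tendsto (fun n => fs n x) atTop (𝓝 (f x))) →
      Tendsto (fun n => I (fs n)) atTop (𝓝 (I f)))
    (hJl : ∀ (fs : ℕ → SimpleFunc X ℝ) (f : X → ℝ) (C : ℝ), (∀ n x, ‖fs n x‖ ≤ C) →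
      (∀ x, Tendsto (fun n => fs n x) atTop (𝓝 (f x))) →
      Tendsto (fun n => J (fs n)) atTop (𝓝 (J f)))
    {f : X → ℝ} (hf : StronglyMeasurable f) {C : ℝ} (hC : ∀ x, ‖f x‖ ≤ C) : I f = J f := by
  have hs : ∀ g : SimpleFunc X ℝ, I g = J g := by
    intro g
    induction g using SimpleFunc.induction with
    | @const c s hs =>
      have := hind c _ hs
      convert this using 2 <;>
      · ext x
        by_cases hx : x ∈ s <;> simp [hx]
    | add _ h1 h2 =>
      rw [SimpleFunc.coe_add, hI, hJ, h1, h2]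
  have hC0 : ∀ x, 0 ≤ C := fun x => (norm_nonneg _).trans (hC x)
  -- On an empty space `C` may be negative, while the bounded approximation below needs `0 ≤ C`.
  by_cases hX : IsEmpty X
  · have : f = ((0 : SimpleFunc X ℝ) : X → ℝ) := by ext x; exact hX.elim x
    rw [this, hs]
  · obtain ⟨x0⟩ := not_isEmpty_iff.1 hX
    have hb : ∀ n x, ‖hf.approxBounded C n x‖ ≤ C := fun n x =>
      hf.norm_approxBounded_le (hC0 x0) n x
    have ht : ∀ x, Tendsto (fun n => hf.approxBounded C n x) atTop (𝓝 (f x)) := fun x =>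
      hf.tendsto_approxBounded_of_norm_le (hC x)
    exact tendsto_nhds_unique (hIl _ f C hb ht)
      ((hJl _ f C hb ht).congr fun n => (hs _).symm)

namespace MeasureTheory.VectorMeasure

omit [NormedSpace ℝ F] in
theorem integrable_simpleFunc (D : VectorMeasure X F) [IsFiniteMeasure D.variation]
    (f : SimpleFunc X ℝ) : D.Integrable f :=
  SimpleFunc.integrable_of_isFiniteMeasure f

theorem tendsto_integral_of_bounded (D : VectorMeasure X F) [IsFiniteMeasure D.variation]
    (B : ℝ →L[ℝ] F →L[ℝ] G) (fs : ℕ → SimpleFunc X ℝ) (f : X → ℝ) (C : ℝ)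
    (hC : ∀ n x, ‖fs n x‖ ≤ C) (h : ∀ x, Tendsto (fun n => fs n x) atTop (𝓝 (f x))) :
    Tendsto (fun n => D.integral (fs n) B) atTop (𝓝 (D.integral f B)) := by
  refine VectorMeasure.tendsto_integral_of_dominated_convergence (fun _ => C) ?_ ?_ ?_ ?_
  · exact fun n => (fs n).stronglyMeasurable.aestronglyMeasurable
  · exact integrable_const _
  · exact fun n => Eventually.of_forall fun x => hC n x
  · exact Eventually.of_forall h

theorem integral_indicator_const_lsmul [CompleteSpace F] (D : VectorMeasure X F)
    [IsFiniteMeasure D.variation] (c : ℝ) {s : Set X} (hs : MeasurableSet s) :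
    D.integral (s.indicator fun _ => c) (ContinuousLinearMap.lsmul ℝ ℝ) = c • D s := by
  rw [VectorMeasure.integral, setToFun_indicator_const _ hs (measure_ne_top _ _)]
  rfl

theorem variation_mapRange_le (D : VectorMeasure X F) (L : F →L[ℝ] G) :
    (D.mapRange L.toLinearMap.toAddMonoidHom L.continuous).variation ≤ ‖L‖ₑ • D.variation := by
  refine variation_le_of_forall_enorm_le fun E _ => ?_
  refine (L.le_opENorm (D E)).trans ?_
  rw [Measure.smul_apply, smul_eq_mul]
  gcongr
  exact D.enorm_measure_le_variation E

/-- Both sides are additive in `f` and stable under bounded convergence, so indicators suffice.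
Applied to `L = ⟨z, ·⟩`, this passes from the vector identity defining `Du` to its component along
`z`. -/
theorem integral_mapRange [CompleteSpace F] [CompleteSpace G] (D : VectorMeasure X F)
    [IsFiniteMeasure D.variation] (L : F →L[ℝ] G) {f : X → ℝ} (hf : StronglyMeasurable f) {C : ℝ}
    (hC : ∀ x, ‖f x‖ ≤ C) :
    (D.mapRange L.toLinearMap.toAddMonoidHom L.continuous).integral f
      (ContinuousLinearMap.lsmul ℝ ℝ) = L (D.integral f (ContinuousLinearMap.lsmul ℝ ℝ)) := by
  have hfin : IsFiniteMeasure
      (D.mapRange L.toLinearMap.toAddMonoidHom L.continuous).variation := by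
    refine ⟨(variation_mapRange_le D L univ).trans_lt ?_⟩
    rw [Measure.smul_apply, smul_eq_mul]
    exact ENNReal.mul_lt_top enorm_lt_top (measure_lt_top _ _)
  refine functional_eq_of_eq_indicator
    (I := fun f => (D.mapRange L.toLinearMap.toAddMonoidHom L.continuous).integral f
      (ContinuousLinearMap.lsmul ℝ ℝ))
    (J := fun f => L (D.integral f (ContinuousLinearMap.lsmul ℝ ℝ))) ?_ ?_ ?_ ?_ ?_ hf hC
  · intro c s hs
    simp only [integral_indicator_const_lsmul _ c hs, _root_.map_smul]
    rfl
  · exact fun f g => integral_add (integrable_simpleFunc _ f) (integrable_simpleFunc _ g)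
  · intro f g
    simp only [integral_add (integrable_simpleFunc D f) (integrable_simpleFunc D g), _root_.map_add]
  · exact tendsto_integral_of_bounded _ _
  · exact fun fs f C h1 h2 => (L.continuous.tendsto _).comp
      (tendsto_integral_of_bounded D _ fs f C h1 h2)

/-- The same reduction to indicators. It allows an integrable function to be handled as a measure
when `p = 1`. -/
theorem integral_withDensity_volume [CompleteSpace F] {μ : Measure X} {g : X → F}
    (hg : Integrable g μ) {f : X → ℝ} (hf : StronglyMeasurable f) {C : ℝ}
    (hC : ∀ x, ‖f x‖ ≤ C) :
    (μ.withDensityᵥ g).integral f (ContinuousLinearMap.lsmul ℝ ℝ) = ∫ x, f x • g x ∂μ := by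
  have hfin : IsFiniteMeasure (μ.withDensityᵥ g).variation := by
    rw [Measure.variation_withDensityᵥ hg]
    exact ⟨by simpa using! hg.2⟩
  have hint : ∀ f : SimpleFunc X ℝ, Integrable (fun x => f x • g x) μ := by
    intro f
    obtain ⟨C, hC⟩ := f.exists_forall_norm_le
    exact hg.bdd_smul C f.stronglyMeasurable.aestronglyMeasurable (Eventually.of_forall hC)
  refine functional_eq_of_eq_indicator
    (I := fun f => (μ.withDensityᵥ g).integral f (ContinuousLinearMap.lsmul ℝ ℝ))
    (J := fun f => ∫ x, f x • g x ∂μ) ?_ ?_ ?_ ?_ ?_ hf hC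
  · intro c s hs
    simp only [integral_indicator_const_lsmul _ c hs, withDensityᵥ_apply hg hs]
    rw [← MeasureTheory.integral_smul, ← MeasureTheory.integral_indicator hs]
    refine MeasureTheory.integral_congr_ae (Eventually.of_forall fun x => ?_)
    by_cases hx : x ∈ s <;> simp [hx]
  · exact fun f g => integral_add (integrable_simpleFunc _ f) (integrable_simpleFunc _ g)
  · intro f g
    rw [← MeasureTheory.integral_add (hint f) (hint g)]
    simp [add_smul]
  · exact tendsto_integral_of_bounded _ _
  · intro fs f C h1 h2
    refine MeasureTheory.tendsto_integral_of_dominated_convergence (fun x => C * ‖g x‖)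
      (fun n => (hint _).1) (hg.norm.const_mul C) ?_ ?_
    · refine fun n => Eventually.of_forall fun x => ?_
      rw [norm_smul]
      gcongr
      exact h1 n x
    · exact Eventually.of_forall fun x => (h2 x).smul_const _

end MeasureTheory.VectorMeasure

end VectorIntegral

/-! ### Total variation and `L^p` norm by testing with smooth functions -/

section Duality

variable {N : ℕ}

/-- Regularity gives a compact `K ⊆ P` and an open `U ⊇ K`, each losing at most `ε / 2`. A bump
equal to `1` on `K` and supported in `U`, cut by a ball for compactness, differs from the indicator
only on `P \ K` and `U \ K`, by at most `1`. -/
theorem exists_contDiff_approx_indicator (ν : Measure (RN N)) [IsFiniteMeasure ν]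
    {P : Set (RN N)} (hP : MeasurableSet P) {ε : ℝ≥0∞} (hε : ε ≠ 0) :
    ∃ φ : RN N → ℝ, ContDiff ℝ ∞ φ ∧ HasCompactSupport φ ∧ (∀ x, φ x ∈ Icc (0 : ℝ) 1) ∧
      ∫⁻ x, ‖φ x - P.indicator (fun _ => (1 : ℝ)) x‖ₑ ∂ν ≤ ε := by
  have hε2 : ε / 2 ≠ 0 := (ENNReal.half_pos hε).ne'
  obtain ⟨K, hKP, hK, hKlt⟩ := hP.exists_isCompact_sdiff_lt (measure_ne_top ν P) hε2
  obtain ⟨U, hKU, hU, hUlt⟩ := K.exists_isOpen_lt_add (measure_ne_top ν K) hε2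
  obtain ⟨R, hR⟩ := hK.isBounded.subset_ball (0 : RN N)
  obtain ⟨f, hf, hr, hs, h1⟩ := exists_contMDiff_support_eq_eq_one_iff
    (modelWithCornersSelf ℝ (RN N)) (n := (⊤ : ℕ∞)) (hU.inter Metric.isOpen_ball)
    hK.isClosed (subset_inter hKU hR)
  have hr' : ∀ x, f x ∈ Icc (0 : ℝ) 1 := fun x => hr (mem_range_self x)
  refine ⟨f, hf.contDiff, ?_, hr', ?_⟩
  · refine HasCompactSupport.of_support_subset_isCompact (isCompact_closedBall (0 : RN N) R) ?_
    rw [hs]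
    exact inter_subset_right.trans Metric.ball_subset_closedBall
  have hUK : ν (U \ K) ≤ ε / 2 := by
    rw [measure_sdiff hKU hK.measurableSet.nullMeasurableSet (measure_ne_top _ _)]
    exact tsub_le_iff_left.2 hUlt.le
  calc ∫⁻ x, ‖f x - P.indicator (fun _ => (1 : ℝ)) x‖ₑ ∂ν
      ≤ ∫⁻ x, ((P \ K).indicator 1 x + (U \ K).indicator 1 x) ∂ν := by
        refine lintegral_mono fun x => ?_
        have hb : ‖f x - P.indicator (fun _ => (1 : ℝ)) x‖ₑ ≤ 1 := by
          rw [Real.enorm_eq_ofReal_abs]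
          refine ENNReal.ofReal_le_one.2 (abs_le.2 ?_)
          have := hr' x
          by_cases hx : x ∈ P <;> simp [hx] <;> constructor <;> linarith [this.1, this.2]
        by_cases hxK : x ∈ K
        · simp [hxK, hKP hxK, (h1 x).1 hxK]
        · by_cases hxP : x ∈ P
          · simp only [Set.mem_sdiff, hxP, hxK, not_false_eq_true, and_self, indicator_of_mem,
              Pi.one_apply] at hb ⊢
            exact hb.trans le_self_add
          · by_cases hxU : x ∈ U
            · simp only [Set.mem_sdiff, hxU, hxK, not_false_eq_true, and_self, indicator_of_mem,
                Pi.one_apply]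
              exact hb.trans le_add_self
            · have : f x = 0 := by
                by_contra h
                have : x ∈ Function.support f := h
                rw [hs] at this
                exact hxU this.1
              simp [this, hxP]
    _ = ν (P \ K) + ν (U \ K) := by
        rw [lintegral_add_left (measurable_one.indicator (hP.diff hK.measurableSet)),
          lintegral_indicator_one (hP.diff hK.measurableSet),
          lintegral_indicator_one (hU.measurableSet.diff hK.measurableSet)]
    _ ≤ ε / 2 + ε / 2 := add_le_add hKlt.le hUK
    _ = ε := ENNReal.add_halves ε

/-- The total variation of a signed measure is controlled by smooth test functions. -/
theorem variation_univ_le_of_forall_test {m : SignedMeasure (RN N)} [IsFiniteMeasure m.variation]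
    {M : ℝ} (h : ∀ φ : RN N → ℝ, ContDiff ℝ ∞ φ → HasCompactSupport φ → (∀ x, |φ x| ≤ 1) →
      |m.integral φ (ContinuousLinearMap.lsmul ℝ ℝ)| ≤ M) :
    m.variation univ ≤ ENNReal.ofReal M := by
  -- Hahn decomposition: the total variation is `m P - m Pᶜ`. If `φ` and `ψ` approximate the
  -- indicators of `P` and `Pᶜ` with values in `[0, 1]`, then `φ - ψ` is an admissible test function
  -- that nearly attains it.
  obtain ⟨P, hP, hpos, hneg, hpp, hnp⟩ := m.toJordanDecomposition_spec
  have hvar : m.variation univ = ENNReal.ofReal (m P - m Pᶜ) := by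
    have h1 : 0 ≤ m P := m.nonneg_of_zero_le_restrict hpos
    have h2 : m Pᶜ ≤ 0 := m.nonpos_of_restrict_le_zero hneg
    rw [← SignedMeasure.totalVariation_eq_variation, SignedMeasure.totalVariation,
      Measure.add_apply, hpp, hnp, m.toMeasureOfZeroLE_apply hpos hP MeasurableSet.univ,
      m.toMeasureOfLEZero_apply hneg hP.compl MeasurableSet.univ, sub_eq_add_neg,
      ENNReal.ofReal_add h1 (by linarith)]
    congr 1
    · rw [← ENNReal.ofReal_eq_coe_nnreal]; simp
    · rw [← ENNReal.ofReal_eq_coe_nnreal]; simp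
  rw [hvar]
  refine ENNReal.ofReal_le_ofReal (le_of_forall_pos_le_add fun ε hε => ?_)
  have hε' : ENNReal.ofReal (ε / 2) ≠ 0 := by simpa using hε
  obtain ⟨φ, hφ, hφc, hφr, hφi⟩ := exists_contDiff_approx_indicator m.variation hP hε'
  obtain ⟨ψ, hψ, hψc, hψr, hψi⟩ := exists_contDiff_approx_indicator m.variation hP.compl hε'
  have hint : ∀ f : RN N → ℝ, ContDiff ℝ ∞ f → HasCompactSupport f → m.Integrable f :=
    fun f hf hc => hf.continuous.integrable_of_hasCompactSupport hc
  have happrox : ∀ (Q : Set (RN N)) (f : RN N → ℝ), MeasurableSet Q → ContDiff ℝ ∞ f →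
      HasCompactSupport f →
      ∫⁻ x, ‖f x - Q.indicator (fun _ => (1 : ℝ)) x‖ₑ ∂m.variation ≤ ENNReal.ofReal (ε / 2) →
      |m.integral f (ContinuousLinearMap.lsmul ℝ ℝ) - m Q| ≤ ε / 2 := by
    intro Q f hQ hf hc hi
    have h0 := VectorMeasure.integral_indicator_const_lsmul m 1 hQ
    rw [one_smul] at h0
    rw [← h0, ← VectorMeasure.integral_sub (hint f hf hc)
      ((integrable_const (1 : ℝ)).indicator hQ), ← Real.norm_eq_abs,
      ← ENNReal.ofReal_le_ofReal_iff (by positivity), ofReal_norm]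
    refine (VectorMeasure.enorm_integral_le_lintegral_enorm_transpose).trans ?_
    rw [VectorMeasure.variation_transpose_lsmul]
    exact hi
  have h1 := abs_le.1 (happrox P φ hP hφ hφc hφi)
  have h2 := abs_le.1 (happrox Pᶜ ψ hP.compl hψ hψc hψi)
  have h3 := h (φ - ψ) (hφ.sub hψ) (hφc.sub hψc) fun x => by
    rw [Pi.sub_apply, abs_le]
    constructor <;> linarith [(hφr x).1, (hφr x).2, (hψr x).1, (hψr x).2]
  rw [VectorMeasure.integral_sub (hint φ hφ hφc) (hint ψ hψ hψc)] at h3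
  linarith [(abs_le.1 h3).2]

theorem holderConjugate_conjExponent {p : ℝ} (hp : 1 ≤ p) :
    (ENNReal.ofReal p).HolderConjugate (ENNReal.ofReal p).conjExponent :=
  ENNReal.HolderConjugate.conjExponent (one_le_ofReal_of_one_le hp)

theorem integrable_mul_conjExponent {p : ℝ} (hp : 1 ≤ p) {φ w : RN N → ℝ}
    (hφ : MemLp φ (ENNReal.ofReal p).conjExponent volume)
    (hw : MemLp w (ENNReal.ofReal p) volume) : Integrable (fun x => φ x * w x) volume := by
  have := holderConjugate_conjExponent hp
  have := this.symm
  exact memLp_one_iff_integrable.1 (hw.mul (r := 1) hφ)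

theorem abs_integral_mul_le {p : ℝ} (hp : 1 ≤ p) {φ w : RN N → ℝ}
    (hφ : MemLp φ (ENNReal.ofReal p).conjExponent volume)
    (hw : MemLp w (ENNReal.ofReal p) volume) :
    |∫ x, φ x * w x| ≤ (eLpNorm φ (ENNReal.ofReal p).conjExponent volume).toReal *
      (eLpNorm w (ENNReal.ofReal p) volume).toReal := by
  have := holderConjugate_conjExponent hp
  have := this.symm
  rw [← ENNReal.toReal_mul, ← Real.norm_eq_abs]
  refine (norm_integral_le_lintegral_norm _).trans (ENNReal.toReal_mono
    (ENNReal.mul_ne_top hφ.2.ne hw.2.ne) ?_)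
  have h := eLpNorm_smul_le_mul_eLpNorm (p := (ENNReal.ofReal p).conjExponent)
    (q := ENNReal.ofReal p) (r := 1) hw.1 hφ.1
  rw [eLpNorm_one_eq_lintegral_enorm] at h
  simp only [ofReal_norm]
  exact h

/-- The `L^p` norm is controlled by pairings with smooth test functions. -/
theorem eLpNorm_le_of_forall_test {p : ℝ} (hp : 1 ≤ p) {w : RN N → ℝ}
    (hw : MemLp w (ENNReal.ofReal p) volume) {M : ℝ} (hM : 0 ≤ M)
    (h : ∀ φ : RN N → ℝ, ContDiff ℝ ∞ φ → HasCompactSupport φ →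
      |∫ x, φ x * w x| ≤ M * (eLpNorm φ (ENNReal.ofReal p).conjExponent volume).toReal) :
    eLpNorm w (ENNReal.ofReal p) volume ≤ ENNReal.ofReal M := by
  -- For `p = 1` the dual exponent is `∞`, where test functions are not dense; the norm is read
  -- instead as the total variation of the measure with density `w`.
  rcases hp.eq_or_lt with rfl | hp1
  · simp only [ENNReal.ofReal_one] at hw h ⊢
    have hwi := memLp_one_iff_integrable.1 hw
    have hvar : (volume.withDensityᵥ w).variation univ = eLpNorm w 1 volume := by
      rw [Measure.variation_withDensityᵥ hwi, withDensity_apply _ MeasurableSet.univ,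
        eLpNorm_one_eq_lintegral_enorm, Measure.restrict_univ]
    have : IsFiniteMeasure (volume.withDensityᵥ w).variation := ⟨hvar ▸ hw.2⟩
    rw [← hvar]
    refine variation_univ_le_of_forall_test fun φ hφ hc h1 => ?_
    rw [VectorMeasure.integral_withDensity_volume hwi hφ.continuous.stronglyMeasurable
      (C := 1) h1]
    refine (h φ hφ hc).trans (mul_le_of_le_one_right hM ?_)
    have e : (1 : ℝ≥0∞).conjExponent = ⊤ := by simp [ENNReal.conjExponent]
    rw [e, ← ENNReal.toReal_one]
    refine ENNReal.toReal_mono ENNReal.one_ne_top ?_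
    rw [eLpNorm_exponent_top]
    refine (eLpNormEssSup_le_of_ae_bound (Eventually.of_forall h1)).trans (by simp)
  have hp0 : 0 < p := by linarith
  set q : ℝ := p / (p - 1) with hq
  have hpq : p.HolderConjugate q := Real.HolderConjugate.conjExponent hp1
  have hqE : (ENNReal.ofReal p).conjExponent = ENNReal.ofReal q := by
    have h1 := holderConjugate_conjExponent hp
    have h2 : (ENNReal.ofReal p).HolderConjugate (ENNReal.ofReal q) := hpq.ennrealOfReal
    exact ENNReal.HolderConjugate.unique (ENNReal.ofReal p) _ _
  have hq0 : 0 < q := hpq.symm.pos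
  have hq1 : 1 ≤ ENNReal.ofReal q := one_le_ofReal_of_one_le hpq.symm.lt.le
  -- The extremal function in Hölder's inequality: `ψ w = |w|^p` and `|ψ|^q = |w|^p`.
  set ψ : RN N → ℝ := fun x => w x * |w x| ^ (p - 2) with hψ
  have hψabs : ∀ x, |ψ x| = |w x| ^ (p - 1) := by
    intro x
    rcases eq_or_ne (w x) 0 with h0 | h0
    · simp [hψ, h0, Real.zero_rpow (by linarith : p - 1 ≠ 0)]
    · rw [hψ]
      simp only [abs_mul, abs_of_nonneg (Real.rpow_nonneg (abs_nonneg (w x)) _)]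
      rw [← Real.rpow_one_add' (abs_nonneg _) (by linarith)]
      congr 1; ring
  have hψw : ∀ x, ψ x * w x = |w x| ^ p := by
    intro x
    rcases eq_or_ne (w x) 0 with h0 | h0
    · simp [hψ, h0, Real.zero_rpow hp0.ne']
    · have : |w x| ^ p = |w x| ^ (2 : ℝ) * |w x| ^ (p - 2) := by
        rw [← Real.rpow_add (abs_pos.2 h0)]; congr 1; ring
      rw [this, Real.rpow_two, sq_abs, hψ]
      ring
  have hψm : AEStronglyMeasurable ψ volume :=
    hw.1.mul (hw.1.norm.aemeasurable.pow_const (p - 2)).aestronglyMeasurable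
  set S : ℝ := (∫⁻ x, ‖w x‖ₑ ^ p).toReal with hS
  have hwS : eLpNorm w (ENNReal.ofReal p) volume = (∫⁻ x, ‖w x‖ₑ ^ p) ^ (1 / p) := by
    rw [eLpNorm_eq_lintegral_rpow_enorm_toReal (by simpa using hp0) ENNReal.ofReal_ne_top,
      ENNReal.toReal_ofReal hp0.le]
  have hSfin : (∫⁻ x, ‖w x‖ₑ ^ p) ≠ ⊤ := by
    intro ht
    have := hw.2
    rw [hwS, ht, ENNReal.top_rpow_of_pos (by positivity)] at this
    exact lt_irrefl _ this
  have hψS : eLpNorm ψ (ENNReal.ofReal q) volume = (∫⁻ x, ‖w x‖ₑ ^ p) ^ (1 / q) := by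
    rw [eLpNorm_eq_lintegral_rpow_enorm_toReal (by simpa using hq0) ENNReal.ofReal_ne_top,
      ENNReal.toReal_ofReal hq0.le]
    congr 1
    refine lintegral_congr fun x => ?_
    rw [Real.enorm_eq_ofReal_abs, Real.enorm_eq_ofReal_abs, hψabs,
      ENNReal.ofReal_rpow_of_nonneg (by positivity) hq0.le,
      ENNReal.ofReal_rpow_of_nonneg (by positivity) hp0.le, ← Real.rpow_mul (abs_nonneg _),
      hpq.sub_one_mul_conj]
  have hψL : MemLp ψ (ENNReal.ofReal q) volume :=
    ⟨hψm, hψS ▸ (ENNReal.rpow_lt_top_of_nonneg (by positivity) hSfin)⟩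
  have hψS' : (eLpNorm ψ (ENNReal.ofReal q) volume).toReal = S ^ (1 / q) := by
    rw [hψS, ← ENNReal.toReal_rpow]
  have hSint : ∫ x, ψ x * w x = S := by
    simp_rw [hψw]
    rw [integral_eq_lintegral_of_nonneg_ae (Eventually.of_forall fun x => by positivity)
      (by simpa only [Real.norm_eq_abs] using
        (hw.1.norm.aemeasurable.pow_const p).aestronglyMeasurable), hS]
    congr 1
    refine lintegral_congr fun x => ?_
    rw [Real.enorm_eq_ofReal_abs, ENNReal.ofReal_rpow_of_nonneg (abs_nonneg _) hp0.le]
  set W : ℝ := (eLpNorm w (ENNReal.ofReal p) volume).toReal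
  have hSle : S ≤ M * S ^ (1 / q) := by
    -- Replace `ψ` by a test function at `L^q` distance `ε`; the error is at most `ε M` in the norm
    -- of the test function and `ε W` in the pairing.
    have key : ∀ ε : ℝ, 0 < ε → S ≤ M * S ^ (1 / q) + ε * (M + W) := by
      intro ε hε
      obtain ⟨φ, hφc, hφ, hφε⟩ := hψL.exist_eLpNorm_sub_le ENNReal.ofReal_ne_top hq1 hε
      have hφL : MemLp φ (ENNReal.ofReal q) volume :=
        hφ.continuous.memLp_of_hasCompactSupport hφc
      have hε' : (eLpNorm (ψ - φ) (ENNReal.ofReal q) volume).toReal ≤ ε :=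
        ENNReal.toReal_le_of_le_ofReal hε.le hφε
      have h1 := h φ hφ hφc
      have h2 := abs_integral_mul_le hp (φ := ψ - φ) (hqE ▸ hψL.sub hφL) hw
      rw [hqE] at h1 h2
      have h3 : (eLpNorm φ (ENNReal.ofReal q) volume).toReal ≤ S ^ (1 / q) + ε := by
        have e : φ = ψ - (ψ - φ) := by simp
        have := eLpNorm_sub_le hψL.1 (hψL.sub hφL).1 hq1
        rw [← e] at this
        rw [← hψS']
        refine (ENNReal.toReal_mono (ENNReal.add_ne_top.2 ⟨hψL.2.ne, (hψL.sub hφL).2.ne⟩)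
          this).trans ?_
        rw [ENNReal.toReal_add hψL.2.ne (hψL.sub hφL).2.ne]
        gcongr
      have h4 : ∫ x, (ψ - φ) x * w x = S - ∫ x, φ x * w x := by
        rw [← hSint, ← integral_sub (integrable_mul_conjExponent hp (hqE ▸ hψL) hw)
          (integrable_mul_conjExponent hp (hqE ▸ hφL) hw)]
        simp only [Pi.sub_apply, sub_mul]
      rw [h4] at h2
      have h5 := (abs_le.1 h2).2
      have h6 := (abs_le.1 h1).2
      have h7 : M * (eLpNorm φ (ENNReal.ofReal q) volume).toReal ≤ M * (S ^ (1 / q) + ε) := by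
        gcongr
      have h8 : (eLpNorm (ψ - φ) (ENNReal.ofReal q) volume).toReal * W ≤ ε * W := by
        gcongr
      linarith
    have ht : Tendsto (fun ε : ℝ => M * S ^ (1 / q) + ε * (M + W)) (𝓝[>] 0)
        (𝓝 (M * S ^ (1 / q) + 0 * (M + W))) :=
      ((continuous_const.add (continuous_id.mul continuous_const)).tendsto 0).mono_left
        nhdsWithin_le_nhds
    simpa using ge_of_tendsto ht (eventually_nhdsWithin_of_forall fun ε hε => key ε hε)
  have hS0 : 0 ≤ S := ENNReal.toReal_nonneg
  have hfinal : S ^ (1 / p) ≤ M := by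
    rcases hS0.eq_or_lt with h0 | h0
    · rw [← h0, Real.zero_rpow (by positivity)]; exact hM
    · have e : S = S ^ (1 / p) * S ^ (1 / q) := by
        rw [← Real.rpow_add h0, one_div, one_div, hpq.inv_add_inv_eq_one, Real.rpow_one]
      exact le_of_mul_le_mul_right (a := S ^ (1 / q)) (by rwa [← e])
        (Real.rpow_pos_of_pos h0 _)
  rw [hwS, ← ENNReal.ofReal_toReal (ENNReal.rpow_ne_top_of_nonneg (by positivity) hSfin),
    ← ENNReal.toReal_rpow]
  exact ENNReal.ofReal_le_ofReal hfinal

end Duality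


/-! ### Difference quotients against distributional derivatives -/

section TestFunctions

variable {N : ℕ} {p : ℝ} {u φ : RN N → ℝ}

theorem continuous_gradient_of_contDiff (hφ : ContDiff ℝ ∞ φ) : Continuous (gradient φ) :=
  (InnerProductSpace.toDual ℝ (RN N)).symm.continuous.comp (hφ.continuous_fderiv (by simp))

theorem hasCompactSupport_gradient (hc : HasCompactSupport φ) : HasCompactSupport (gradient φ) :=
  (hc.fderiv ℝ).comp_left (map_zero (InnerProductSpace.toDual ℝ (RN N)).symm)

theorem inner_gradient_eq_fderiv (x z : RN N) : inner ℝ z (gradient φ x) = fderiv ℝ φ x z := by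
  rw [real_inner_comm, inner_gradient_left]

/-- Differentiation of the pairing of `u` with the translates of a test function. -/
theorem hasDerivAt_integral_mul_translate (hu : LocallyIntegrable u volume)
    (hφ : ContDiff ℝ ∞ φ) (hc : HasCompactSupport φ) (z : RN N) (t : ℝ) :
    HasDerivAt (fun s : ℝ => ∫ x, u x * φ (x - s • z))
      (-∫ x, u x * fderiv ℝ φ (x - t • z) z) t := by
  -- With the reflected function, the pairing is the convolution `u ⋆ ψ` at `s • z`, which can be
  -- differentiated.
  set ψ : RN N → ℝ := fun y => φ (-y) with hψ
  have hψs : ContDiff ℝ 1 ψ := (hφ.comp contDiff_neg).of_le (by exact_mod_cast le_top)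
  have hψc : HasCompactSupport ψ := hc.comp_homeomorph (Homeomorph.neg (RN N))
  have hder := hψc.hasFDerivAt_convolution_right (ContinuousLinearMap.mul ℝ ℝ) hu hψs (t • z)
  have hline : HasDerivAt (fun s : ℝ => s • z) z t := by
    simpa using (hasDerivAt_id t).smul_const z
  have h := hder.comp_hasDerivAt t hline
  rw [convolution_precompR_apply _ hu (hψc.fderiv ℝ) (hψs.continuous_fderiv one_ne_zero)] at h
  have e1 : (fun s : ℝ => ∫ x, u x * φ (x - s • z)) =
      (convolution u ψ (ContinuousLinearMap.mul ℝ ℝ) volume) ∘ fun s : ℝ => s • z := by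
    ext s
    simp [convolution_def, hψ]
  have e2 : -∫ x, u x * fderiv ℝ φ (x - t • z) z = convolution u (fun a => fderiv ℝ ψ a z)
      (ContinuousLinearMap.mul ℝ ℝ) volume (t • z) := by
    rw [convolution_def, ← integral_neg]
    refine integral_congr_ae (Eventually.of_forall fun x => ?_)
    have : fderiv ℝ ψ (t • z - x) z = - fderiv ℝ φ (x - t • z) z := by
      have hd : HasFDerivAt ψ ((fderiv ℝ φ (-(t • z - x))).comp (-ContinuousLinearMap.id ℝ (RN N)))
          (t • z - x) :=
        ((hφ.differentiable (by simp)) _).hasFDerivAt.comp _ (hasFDerivAt_id _).neg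
      rw [hd.fderiv]
      simp
    simp [this]
  rw [e1, e2]
  exact h

theorem integral_mul_translate_sub (hu : LocallyIntegrable u volume) (hφ : Continuous φ)
    (hc : HasCompactSupport φ) (z : RN N) :
    (∫ x, u x * φ (x - z)) - ∫ x, u x * φ x = ∫ x, φ x * (u (x + z) - u x) := by
  have h1 : Integrable (fun x => u x * φ (x - z)) volume :=
    hu.integrable_smul_right_of_hasCompactSupport (hφ.comp (continuous_sub_right z))
      (hc.comp_homeomorph (Homeomorph.subRight z))
  have h2 : Integrable (fun x => u x * φ x) volume :=
    hu.integrable_smul_right_of_hasCompactSupport hφ hc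
  have h3 := h1.comp_add_right z
  have h4 := integral_add_right_eq_self (μ := volume) (fun x => u x * φ (x - z)) z
  simp only [add_sub_cancel_right] at h3 h4
  rw [← h4, ← integral_sub h3 h2]
  congr 1
  ext x
  ring

theorem eLpNorm_comp_sub_right {q : ℝ≥0∞} (hφ : Continuous φ) (z : RN N) :
    eLpNorm (fun x => φ (x - z)) q volume = eLpNorm φ q volume :=
  eLpNorm_comp_measurePreserving hφ.aestronglyMeasurable (measurePreserving_sub_right volume z)

/-- A bound for the distributional derivative of `u` along `z` bounds the difference of `u` and its
translate. -/
theorem diffNorm_le_of_forall_test (hp : 1 ≤ p) (hu : MemLp u (ENNReal.ofReal p) volume)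
    {M : ℝ} (hM : 0 ≤ M) {z : RN N}
    (h : ∀ φ : RN N → ℝ, ContDiff ℝ ∞ φ → HasCompactSupport φ →
      |∫ x, u x * fderiv ℝ φ x z| ≤
        M * (eLpNorm φ (ENNReal.ofReal p).conjExponent volume).toReal) :
    diffNorm p u z ≤ M := by
  refine ENNReal.toReal_le_of_le_ofReal hM
    (eLpNorm_le_of_forall_test hp (memLp_diff hu z) hM fun φ hφ hc => ?_)
  have hul := hu.locallyIntegrable (one_le_ofReal_of_one_le hp)
  rw [← integral_mul_translate_sub hul hφ.continuous hc z]
  -- Mean value inequality along the segment from `0` to `z`; the bound is uniform because all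
  -- translates of `φ` have the same dual norm.
  have := norm_image_sub_le_of_norm_deriv_le_segment_01'
    (f := fun s : ℝ => ∫ x, u x * φ (x - s • z))
    (f' := fun t => -∫ x, u x * fderiv ℝ φ (x - t • z) z)
    (C := M * (eLpNorm φ (ENNReal.ofReal p).conjExponent volume).toReal)
    (fun t _ => (hasDerivAt_integral_mul_translate hul hφ hc z t).hasDerivWithinAt)
    (fun t _ => ?_)
  · simpa using this
  · rw [norm_neg, Real.norm_eq_abs, ← eLpNorm_comp_sub_right hφ.continuous (t • z)]
    have h1 := h (fun x => φ (x - t • z)) (hφ.comp (contDiff_id.sub contDiff_const))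
      (hc.comp_homeomorph (Homeomorph.subRight (t • z)))
    simpa only [fderiv_comp_sub] using h1

/-- A bound for the difference quotients of `u` along `z` bounds the distributional derivative of
`u` along `z`. -/
theorem abs_integral_mul_fderiv_le (hp : 1 ≤ p) (hu : MemLp u (ENNReal.ofReal p) volume)
    {M : ℝ} {z : RN N} (h : ∀ s : ℝ, 0 < s → diffNorm p u (s • z) ≤ s * M)
    (hφ : ContDiff ℝ ∞ φ) (hc : HasCompactSupport φ) :
    |∫ x, u x * fderiv ℝ φ x z| ≤
      M * (eLpNorm φ (ENNReal.ofReal p).conjExponent volume).toReal := by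
  have hul := hu.locallyIntegrable (one_le_ofReal_of_one_le hp)
  have hd := (hasDerivAt_integral_mul_translate hul hφ hc z 0).tendsto_slope_zero
  simp only [zero_smul, sub_zero, zero_add] at hd
  have hd' := (hd.mono_left (nhdsWithin_mono 0 (fun s (hs : s ∈ Ioi (0 : ℝ)) => ne_of_gt hs))).abs
  rw [abs_neg] at hd'
  refine le_of_tendsto hd' (eventually_nhdsWithin_of_forall fun s hs => ?_)
  have hs : 0 < s := hs
  rw [integral_mul_translate_sub hul hφ.continuous hc, smul_eq_mul, abs_mul, abs_inv,
    abs_of_pos hs, inv_mul_le_iff₀ hs]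
  refine (abs_integral_mul_le hp (hφ.continuous.memLp_of_hasCompactSupport hc)
    (memLp_diff hu (s • z))).trans ?_
  rw [mul_comm, ← mul_assoc]
  exact mul_le_mul_of_nonneg_right (h s hs) ENNReal.toReal_nonneg

end TestFunctions

/-! ### The norm of the directional derivative as a supremum of difference quotients -/

section DirectionalDerivative

variable {N : ℕ} {p : ℝ} {u φ : RN N → ℝ}

theorem integral_mul_fderiv_eq_inner (hu : LocallyIntegrable u volume) (hφ : ContDiff ℝ ∞ φ)
    (hc : HasCompactSupport φ) (z : RN N) :
    ∫ x, u x * fderiv ℝ φ x z = inner ℝ z (∫ x, u x • gradient φ x) := by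
  have hi : Integrable (fun x => u x • gradient φ x) volume :=
    hu.integrable_smul_right_of_hasCompactSupport (continuous_gradient_of_contDiff hφ)
      (hasCompactSupport_gradient hc)
  have := (innerSL ℝ z).integral_comp_comm hi
  simp only [innerSL_apply_apply, inner_smul_right, inner_gradient_eq_fderiv] at this
  exact this

theorem IsWeakGradient.integral_mul_fderiv {g : RN N → RN N} (h : IsWeakGradient u g)
    (hφ : ContDiff ℝ ∞ φ) (hc : HasCompactSupport φ) (z : RN N) :
    ∫ x, u x * fderiv ℝ φ x z = - ∫ x, φ x * inner ℝ z (g x) := by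
  rw [integral_mul_fderiv_eq_inner h.1 hφ hc, h.2.2 φ hφ hc, inner_neg_right]
  have hi : Integrable (fun x => φ x • g x) volume :=
    h.2.1.integrable_smul_left_of_hasCompactSupport hφ.continuous hc
  have := (innerSL ℝ z).integral_comp_comm hi
  simp only [innerSL_apply_apply, inner_smul_right] at this
  rw [this]

theorem IsGradientMeasure.integral_mul_fderiv {D : VectorMeasure (RN N) (RN N)}
    (h : IsGradientMeasure u D) (hφ : ContDiff ℝ ∞ φ) (hc : HasCompactSupport φ) (z : RN N) :
    ∫ x, u x * fderiv ℝ φ x z =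
      - (dotMeasure z D).integral φ (ContinuousLinearMap.lsmul ℝ ℝ) := by
  have hfin : IsFiniteMeasure D.variation := ⟨h.2.1⟩
  obtain ⟨C, hC⟩ := hc.exists_bound_of_continuous hφ.continuous
  rw [integral_mul_fderiv_eq_inner h.1 hφ hc, h.2.2 φ hφ hc, inner_neg_right]
  congr 1
  exact (D.integral_mapRange (innerSL ℝ z) hφ.continuous.stronglyMeasurable hC).symm

theorem variation_dotMeasure_le (D : VectorMeasure (RN N) (RN N)) (z : RN N) :
    (dotMeasure z D).variation univ ≤ ‖z‖ₑ * D.variation univ := by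
  have := D.variation_mapRange_le (innerSL ℝ z) univ
  rwa [Measure.smul_apply, smul_eq_mul, ← ofReal_norm, innerSL_apply_norm, ofReal_norm] at this

/-- The set where the bound holds is closed and of full measure, hence dense and so everything. An
almost everywhere bound would not do for `p = 1`, as `Du` may be singular. -/
theorem abs_le_eLpNorm_top (hφ : Continuous φ) (hc : HasCompactSupport φ) (x : RN N) :
    |φ x| ≤ (eLpNorm φ ⊤ volume).toReal := by
  have hL : MemLp φ ⊤ volume := hφ.memLp_of_hasCompactSupport hc
  have hae : ∀ᵐ y, |φ y| ≤ (eLpNorm φ ⊤ volume).toReal := by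
    filter_upwards [enorm_ae_le_eLpNormEssSup φ volume] with y hy
    have := ENNReal.toReal_mono (by simpa using hL.2.ne) hy
    simpa using this
  have hcl : IsClosed {y | |φ y| ≤ (eLpNorm φ ⊤ volume).toReal} :=
    isClosed_le hφ.abs continuous_const
  have hun := (Measure.dense_of_ae hae).closure_eq
  rw [hcl.closure_eq] at hun
  exact hun.symm.subset (mem_univ x)

theorem MemS.memLp (hu : MemS p u) : MemLp u (ENNReal.ofReal p) volume := by
  rcases hu with ⟨rfl, h⟩ | ⟨_, h⟩
  · simpa using h.1
  · exact h.1

/-- The distributional derivative along `z` is the measure or function `⟨z, Du⟩`, whose size is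
detected by test functions. Together with `MemS.abs_integral_mul_fderiv_le` this identifies its norm
as the best constant in the estimate. -/
theorem MemS.dirNormPow_le_of_forall_test (hu : MemS p u) {M : ℝ} (hM : 0 ≤ M) {z : RN N}
    (h : ∀ φ : RN N → ℝ, ContDiff ℝ ∞ φ → HasCompactSupport φ →
      |∫ x, u x * fderiv ℝ φ x z| ≤
        M * (eLpNorm φ (ENNReal.ofReal p).conjExponent volume).toReal) :
    dirNormPow p u z ≤ ENNReal.ofReal (M ^ p) := by
  rcases hu with ⟨rfl, -, D, hD⟩ | ⟨hp1, huL, g, hg, hgL⟩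
  · have hfin : IsFiniteMeasure (dotMeasure z D).variation :=
      ⟨(variation_dotMeasure_le D z).trans_lt (ENNReal.mul_lt_top enorm_lt_top hD.2.1)⟩
    rw [dirNormPow, if_pos rfl, hD.gradientMeasure_eq, SignedMeasure.totalVariation_eq_variation,
      Real.rpow_one]
    refine variation_univ_le_of_forall_test fun φ hφ hc h1 => ?_
    rw [← abs_neg, ← hD.integral_mul_fderiv hφ hc]
    refine (h φ hφ hc).trans (mul_le_of_le_one_right hM ?_)
    have e : (1 : ℝ≥0∞).conjExponent = ⊤ := by simp [ENNReal.conjExponent]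
    rw [ENNReal.ofReal_one, e, ← ENNReal.toReal_one]
    refine ENNReal.toReal_mono ENNReal.one_ne_top ?_
    rw [eLpNorm_exponent_top]
    exact (eLpNormEssSup_le_of_ae_bound (Eventually.of_forall h1)).trans (by simp)
  · have hp0 : 0 < p := by linarith
    have hw : MemLp (fun x => inner ℝ z (g x)) (ENNReal.ofReal p) volume :=
      hgL.continuousLinearMap_comp (innerSL ℝ z)
    have := eLpNorm_le_of_forall_test hp1.le hw hM fun φ hφ hc => by
      rw [← abs_neg, ← hg.integral_mul_fderiv hφ hc]
      exact h φ hφ hc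
    rw [dirNormPow, if_neg hp1.ne', ← ENNReal.ofReal_rpow_of_nonneg hM hp0.le]
    refine le_trans (le_of_eq ?_) (ENNReal.rpow_le_rpow this hp0.le)
    rw [eLpNorm_eq_lintegral_rpow_enorm_toReal (by simpa using hp0) ENNReal.ofReal_ne_top,
      ENNReal.toReal_ofReal hp0.le, ← ENNReal.rpow_mul, one_div, inv_mul_cancel₀ hp0.ne',
      ENNReal.rpow_one]
    refine lintegral_congr_ae ?_
    filter_upwards [hg.weakGradient_ae_eq] with x hx
    rw [hx, Real.enorm_eq_ofReal_abs, ENNReal.ofReal_rpow_of_nonneg (abs_nonneg _) hp0.le]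

theorem MemS.exists_dirNormPow_le (hu : MemS p u) :
    ∃ K : ℝ, 0 ≤ K ∧ ∀ z : RN N, dirNormPow p u z ≤ ENNReal.ofReal ((K * ‖z‖) ^ p) := by
  rcases hu with ⟨rfl, -, D, hD⟩ | ⟨hp1, huL, g, hg, hgL⟩
  · refine ⟨(D.variation univ).toReal, ENNReal.toReal_nonneg, fun z => ?_⟩
    rw [dirNormPow, if_pos rfl, hD.gradientMeasure_eq, SignedMeasure.totalVariation_eq_variation,
      Real.rpow_one, ENNReal.ofReal_mul ENNReal.toReal_nonneg, ENNReal.ofReal_toReal hD.2.1.ne,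
      mul_comm, ofReal_norm]
    exact variation_dotMeasure_le D z
  · have hp0 : 0 < p := by linarith
    refine ⟨(eLpNorm g (ENNReal.ofReal p) volume).toReal, ENNReal.toReal_nonneg, fun z => ?_⟩
    have hgp : eLpNorm g (ENNReal.ofReal p) volume ^ p = ∫⁻ x, ‖g x‖ₑ ^ p := by
      rw [eLpNorm_eq_lintegral_rpow_enorm_toReal (by simpa using hp0) ENNReal.ofReal_ne_top,
        ENNReal.toReal_ofReal hp0.le, ← ENNReal.rpow_mul, one_div, inv_mul_cancel₀ hp0.ne',
        ENNReal.rpow_one]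
    rw [dirNormPow, if_neg hp1.ne', ← ENNReal.ofReal_rpow_of_nonneg (by positivity) hp0.le,
      ENNReal.ofReal_mul ENNReal.toReal_nonneg, ENNReal.ofReal_toReal hgL.2.ne, ofReal_norm,
      ENNReal.mul_rpow_of_nonneg _ _ hp0.le, hgp, mul_comm, ← lintegral_const_mul' _ _
        (ENNReal.rpow_ne_top_of_nonneg hp0.le enorm_ne_top)]
    refine lintegral_mono_ae ?_
    filter_upwards [hg.weakGradient_ae_eq] with x hx
    rw [hx, ← ENNReal.mul_rpow_of_nonneg _ _ hp0.le, ← ENNReal.ofReal_rpow_of_nonneg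
      (abs_nonneg _) hp0.le, ← Real.enorm_eq_ofReal_abs]
    refine ENNReal.rpow_le_rpow ?_ hp0.le
    rw [← ofReal_norm, ← ofReal_norm z, ← ofReal_norm (g x), ← ENNReal.ofReal_mul (norm_nonneg _)]
    exact ENNReal.ofReal_le_ofReal (norm_inner_le_norm z (g x))

theorem MemS.abs_integral_mul_fderiv_le (hp : 1 ≤ p) (hu : MemS p u) (hφ : ContDiff ℝ ∞ φ)
    (hc : HasCompactSupport φ) (z : RN N) :
    |∫ x, u x * fderiv ℝ φ x z| ≤ (dirNormPow p u z).toReal ^ (1 / p) *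
      (eLpNorm φ (ENNReal.ofReal p).conjExponent volume).toReal := by
  rcases hu with ⟨rfl, -, D, hD⟩ | ⟨hp1, huL, g, hg, hgL⟩
  · have hfin : (dotMeasure z D).variation univ < ⊤ :=
      (variation_dotMeasure_le D z).trans_lt (ENNReal.mul_lt_top enorm_lt_top hD.2.1)
    have e : (1 : ℝ≥0∞).conjExponent = ⊤ := by simp [ENNReal.conjExponent]
    rw [dirNormPow, if_pos rfl, hD.gradientMeasure_eq, SignedMeasure.totalVariation_eq_variation,
      hD.integral_mul_fderiv hφ hc, abs_neg, ENNReal.ofReal_one, e, div_one, Real.rpow_one,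
      ← ENNReal.toReal_mul, ← Real.norm_eq_abs, ← toReal_enorm]
    have htop : eLpNorm φ ⊤ volume ≠ ⊤ := (hφ.continuous.memLp_of_hasCompactSupport hc).2.ne
    refine ENNReal.toReal_mono (ENNReal.mul_ne_top hfin.ne htop) ?_
    refine (VectorMeasure.enorm_integral_le_lintegral_enorm_transpose).trans ?_
    rw [VectorMeasure.variation_transpose_lsmul, mul_comm, ← lintegral_const]
    refine lintegral_mono fun x => ?_
    rw [Real.enorm_eq_ofReal_abs]
    exact ENNReal.ofReal_le_of_le_toReal (abs_le_eLpNorm_top hφ.continuous hc x)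
  · have hp0 : 0 < p := by linarith
    have hw : MemLp (fun x => inner ℝ z (g x)) (ENNReal.ofReal p) volume :=
      hgL.continuousLinearMap_comp (innerSL ℝ z)
    rw [hg.integral_mul_fderiv hφ hc, abs_neg]
    refine (abs_integral_mul_le hp (hφ.continuous.memLp_of_hasCompactSupport hc) hw).trans
      (le_of_eq ?_)
    rw [mul_comm]
    congr 1
    rw [eLpNorm_eq_lintegral_rpow_enorm_toReal (by simpa using hp0) ENNReal.ofReal_ne_top,
      ENNReal.toReal_ofReal hp0.le, ← ENNReal.toReal_rpow, dirNormPow, if_neg hp1.ne']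
    congr 2
    refine lintegral_congr_ae ?_
    filter_upwards [hg.weakGradient_ae_eq] with x hx
    rw [hx, Real.enorm_eq_ofReal_abs, ENNReal.ofReal_rpow_of_nonneg (abs_nonneg _) hp0.le]

theorem MemS.dirNormPow_lt_top (hu : MemS p u) (z : RN N) : dirNormPow p u z < ⊤ := by
  obtain ⟨K, -, hK⟩ := hu.exists_dirNormPow_le
  exact (hK z).trans_lt ENNReal.ofReal_lt_top

/-- The difference quotients of `u` along `z` are bounded by the norm of the directional
derivative. -/
theorem MemS.diffNorm_smul_le (hp : 1 ≤ p) (hu : MemS p u) (z : RN N) {s : ℝ} (hs : 0 ≤ s) :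
    diffNorm p u (s • z) ≤ s * (dirNormPow p u z).toReal ^ (1 / p) := by
  refine diffNorm_le_of_forall_test hp hu.memLp (by positivity) fun φ hφ hc => ?_
  simp only [map_smul, smul_eq_mul, mul_left_comm _ s]
  rw [integral_const_mul, abs_mul, abs_of_nonneg hs, mul_assoc]
  exact mul_le_mul_of_nonneg_left (hu.abs_integral_mul_fderiv_le hp hφ hc z) hs

/-- The norm of the directional derivative is bounded by the difference quotients. -/
theorem MemS.dirNormPow_le (hp : 1 ≤ p) (hu : MemS p u) {M : ℝ} (hM : 0 ≤ M) {z : RN N}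
    (h : ∀ s : ℝ, 0 < s → diffNorm p u (s • z) ≤ s * M) :
    dirNormPow p u z ≤ ENNReal.ofReal (M ^ p) :=
  hu.dirNormPow_le_of_forall_test hM fun _ hφ hc =>
    _root_.abs_integral_mul_fderiv_le hp hu.memLp h hφ hc

theorem MemS.ofReal_div_rpow_le (hp : 1 ≤ p) (hu : MemS p u) (z : RN N) {s : ℝ} (hs : 0 < s) :
    ENNReal.ofReal ((diffNorm p u (s • z) / s) ^ p) ≤ dirNormPow p u z := by
  have hp0 : 0 < p := by linarith
  rw [← ENNReal.ofReal_toReal (hu.dirNormPow_lt_top z).ne]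
  refine ENNReal.ofReal_le_ofReal ?_
  have h1 : diffNorm p u (s • z) / s ≤ (dirNormPow p u z).toReal ^ (1 / p) := by
    rw [div_le_iff₀' hs]
    exact hu.diffNorm_smul_le hp z hs.le
  refine (Real.rpow_le_rpow (div_nonneg (diffNorm_nonneg _) hs.le) h1 hp0.le).trans ?_
  rw [← Real.rpow_mul ENNReal.toReal_nonneg, one_div, inv_mul_cancel₀ hp0.ne', Real.rpow_one]

theorem MemS.exists_diffNorm_le (hp : 1 ≤ p) (hu : MemS p u) :
    ∃ K : ℝ, 0 ≤ K ∧ ∀ z : RN N, diffNorm p u z ≤ K * ‖z‖ := by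
  have hp0 : 0 < p := by linarith
  obtain ⟨K, hK, h⟩ := hu.exists_dirNormPow_le
  refine ⟨K, hK, fun z => ?_⟩
  have h1 := hu.diffNorm_smul_le hp z zero_le_one
  rw [one_smul, one_mul] at h1
  refine h1.trans ?_
  have h2 := Real.rpow_le_rpow ENNReal.toReal_nonneg
    (ENNReal.toReal_le_of_le_ofReal (by positivity) (h z)) (by positivity : 0 ≤ 1 / p)
  rwa [← Real.rpow_mul (by positivity), mul_one_div_cancel hp0.ne', Real.rpow_one] at h2

/-- Smooth compactly supported functions are Sobolev and of bounded variation. -/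
theorem memS_of_contDiff (hp : 1 ≤ p) (hu : ContDiff ℝ ∞ u) (hc : HasCompactSupport u) :
    MemS p u := by
  have hgc := continuous_gradient_of_contDiff hu
  have hgs := hasCompactSupport_gradient hc
  have hgi : Integrable (gradient u) volume := hgc.integrable_of_hasCompactSupport hgs
  have hul : LocallyIntegrable u volume := hu.continuous.locallyIntegrable
  have hparts : ∀ φ : RN N → ℝ, ContDiff ℝ ∞ φ → HasCompactSupport φ →
      ∫ x, u x • gradient φ x = - ∫ x, φ x • gradient u x := by
    intro φ hφ hφc
    refine ext_inner_left ℝ fun z => ?_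
    rw [← integral_mul_fderiv_eq_inner hul hφ hφc, inner_neg_right,
      ← integral_mul_fderiv_eq_inner hφ.continuous.locallyIntegrable hu hc]
    have hcf : Continuous fun x => fderiv ℝ φ x z :=
      (hφ.continuous_fderiv (by simp)).clm_apply continuous_const
    have hcu : Continuous fun x => fderiv ℝ u x z :=
      (hu.continuous_fderiv (by simp)).clm_apply continuous_const
    rw [integral_mul_fderiv_eq_neg_fderiv_mul_of_integrable]
    · simp only [mul_comm]
    · exact (hcu.mul hφ.continuous).integrable_of_hasCompactSupport hφc.mul_left
    · exact (hu.continuous.mul hcf).integrable_of_hasCompactSupport hc.mul_right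
    · exact (hu.continuous.mul hφ.continuous).integrable_of_hasCompactSupport hc.mul_right
    · exact fun x _ => hu.differentiable (by simp) x
    · exact fun x _ => hφ.differentiable (by simp) x
  rcases hp.eq_or_lt with rfl | hp1
  · refine Or.inl ⟨rfl, hu.continuous.memLp_of_hasCompactSupport hc,
      volume.withDensityᵥ (gradient u), hul, ?_, fun φ hφ hφc => ?_⟩
    · rw [Measure.variation_withDensityᵥ hgi, withDensity_apply _ MeasurableSet.univ,
        Measure.restrict_univ]
      exact hgi.2
    · obtain ⟨C, hC⟩ := hφc.exists_bound_of_continuous hφ.continuous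
      rw [VectorMeasure.integral_withDensity_volume hgi hφ.continuous.stronglyMeasurable hC]
      exact hparts φ hφ hφc
  · exact Or.inr ⟨hp1, hu.continuous.memLp_of_hasCompactSupport hc, gradient u,
      ⟨hul, hgc.locallyIntegrable, hparts⟩, hgc.memLp_of_hasCompactSupport hgs⟩

end DirectionalDerivative


/-! ### Measures with a locally integrable kernel -/

section KernelMeasure

variable {N : ℕ} {κ : RN N → ℝ}

theorem ofReal_rpow_mul_lintegral_kernel (hκ : AEMeasurable κ volume) (p : ℝ) {R : ℝ}
    (hR : 0 < R) :
    ENNReal.ofReal (R ^ p) * ∫⁻ z, ENNReal.ofReal (κ z / (R ^ p + ‖z‖ ^ p)) =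
      ∫⁻ z, ENNReal.ofReal (R ^ p / (R ^ p + ‖z‖ ^ p)) ∂(kernelMeasure κ) := by
  have hRp : 0 < R ^ p := Real.rpow_pos_of_pos hR p
  rw [kernelMeasure, lintegral_withDensity_eq_lintegral_mul_non_measurable₀ _ hκ.ennreal_ofReal
    (Eventually.of_forall fun _ => ENNReal.ofReal_lt_top), ← lintegral_const_mul' _ _
    ENNReal.ofReal_ne_top]
  refine lintegral_congr fun z => ?_
  have hz : 0 ≤ ‖z‖ ^ p := by positivity
  rw [Pi.mul_apply, mul_comm (ENNReal.ofReal (κ z)), ← ENNReal.ofReal_mul hRp.le,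
    ← ENNReal.ofReal_mul (by positivity)]
  congr 1
  ring

theorem kernelMeasure_lt_top_of_isCompact (hκ : LocallyIntegrable κ volume) {K : Set (RN N)}
    (hK : IsCompact K) : kernelMeasure κ K < ⊤ := by
  rw [kernelMeasure, withDensity_apply _ hK.measurableSet]
  refine lt_of_le_of_lt (lintegral_mono fun z => ?_) (hκ.integrableOn_isCompact hK).2
  rw [Real.enorm_eq_ofReal_abs]
  exact ENNReal.ofReal_le_ofReal (le_abs_self _)

theorem isFiniteMeasureOnCompacts_kernelMeasure (hκ : LocallyIntegrable κ volume) :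
    IsFiniteMeasureOnCompacts (kernelMeasure κ) :=
  ⟨fun _ hK => kernelMeasure_lt_top_of_isCompact hκ hK⟩

theorem ae_ne_zero_kernelMeasure (hN : 0 < N) : ∀ᵐ z ∂(kernelMeasure κ), z ≠ 0 := by
  have : Nonempty (Fin N) := ⟨⟨0, hN⟩⟩
  exact (withDensity_absolutelyContinuous _ _).ae_le (Measure.ae_ne volume 0)

end KernelMeasure

/-! ### Behaviour under dilations -/

section Rescaling

variable {N : ℕ} {p : ℝ} {u : RN N → ℝ}

/-- The function `x ↦ u (x / R)`. -/
def rescale (R : ℝ) (u : RN N → ℝ) : RN N → ℝ := fun x => u (R⁻¹ • x)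

theorem rescale_inv_rescale {R : ℝ} (hR : 0 < R) : rescale R⁻¹ (rescale R u) = u := by
  ext x
  simp [rescale, smul_smul, hR.ne']

theorem contDiff_rescale (R : ℝ) (hu : ContDiff ℝ ∞ u) : ContDiff ℝ ∞ (rescale R u) :=
  hu.comp (contDiff_const_smul R⁻¹)

theorem hasCompactSupport_rescale {R : ℝ} (hR : 0 < R) (hu : HasCompactSupport u) :
    HasCompactSupport (rescale R u) :=
  hu.comp_homeomorph (Homeomorph.smulOfNeZero R⁻¹ (inv_ne_zero hR.ne'))

theorem diffNorm_rescale_rpow (hp : 1 ≤ p) (hu : MemLp u (ENNReal.ofReal p) volume) {R : ℝ}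
    (hR : 0 < R) (hv : MemLp (rescale R u) (ENNReal.ofReal p) volume) (z : RN N) :
    diffNorm p (rescale R u) z ^ p = R ^ N * diffNorm p u (R⁻¹ • z) ^ p := by
  rw [← ENNReal.ofReal_eq_ofReal_iff (Real.rpow_nonneg (diffNorm_nonneg _) _)
    (mul_nonneg (by positivity) (Real.rpow_nonneg (diffNorm_nonneg _) _)),
    ENNReal.ofReal_mul (by positivity), ofReal_diffNorm_rpow hp hv, ofReal_diffNorm_rpow hp hu]
  have hemb : MeasurableEmbedding (fun x : RN N => R⁻¹ • x) :=
    (Homeomorph.smulOfNeZero R⁻¹ (inv_ne_zero hR.ne')).measurableEmbedding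
  have h := hemb.lintegral_map (μ := volume)
    (fun x => ENNReal.ofReal (|u (x + R⁻¹ • z) - u x| ^ p))
  rw [Measure.map_addHaar_smul volume (inv_ne_zero hR.ne'), lintegral_smul_measure] at h
  simp only [rescale, smul_add]
  rw [← h, finrank_euclideanSpace_fin, inv_pow, inv_inv, abs_of_pos (by positivity), smul_eq_mul]

theorem diffNorm_rescale_div_rpow (hp : 1 ≤ p) (hu : MemLp u (ENNReal.ofReal p) volume) {R : ℝ}
    (hR : 0 < R) (hv : MemLp (rescale R u) (ENNReal.ofReal p) volume) (z : RN N) :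
    (diffNorm p (rescale R u) z / ‖z‖) ^ p =
      R ^ N / R ^ p * (diffNorm p u (R⁻¹ • z) / ‖R⁻¹ • z‖) ^ p := by
  rw [Real.div_rpow (diffNorm_nonneg _) (norm_nonneg _), diffNorm_rescale_rpow hp hu hR hv,
    Real.div_rpow (diffNorm_nonneg _) (norm_nonneg _), norm_smul, norm_inv, Real.norm_eq_abs,
    abs_of_pos hR, Real.mul_rpow (by positivity) (norm_nonneg _), Real.inv_rpow hR.le]
  have : R ^ p ≠ 0 := (Real.rpow_pos_of_pos hR p).ne'
  field_simp

/-- Difference quotients dilate by a change of variables, and `MemS.dirNormPow_le` recovers the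
derivative from them, so `Du` itself never has to be transformed. -/
theorem dirNormPow_rescale_le (hp : 1 ≤ p) (hu : MemS p u) {R : ℝ} (hR : 0 < R)
    (hv : MemS p (rescale R u)) (z : RN N) :
    dirNormPow p (rescale R u) z ≤ ENNReal.ofReal (R ^ N / R ^ p) * dirNormPow p u z := by
  have hp0 : 0 < p := by linarith
  have hRp : 0 < R ^ p := Real.rpow_pos_of_pos hR p
  have hA := ENNReal.toReal_nonneg (a := dirNormPow p u z)
  set A := (dirNormPow p u z).toReal
  have hle : dirNormPow p (rescale R u) z ≤
      ENNReal.ofReal (((R ^ N / R ^ p * A) ^ (1 / p)) ^ p) := by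
    refine hv.dirNormPow_le hp (by positivity) fun s hs => ?_
    have h1 : diffNorm p (rescale R u) (s • z) ^ p ≤ (s * (R ^ N / R ^ p * A) ^ (1 / p)) ^ p := by
      rw [diffNorm_rescale_rpow hp hu.memLp hR hv.memLp, smul_smul,
        Real.mul_rpow hs.le (by positivity), ← Real.rpow_mul (by positivity), one_div,
        inv_mul_cancel₀ hp0.ne', Real.rpow_one]
      have h2 := Real.rpow_le_rpow (diffNorm_nonneg _)
        (hu.diffNorm_smul_le hp z (mul_nonneg (inv_nonneg.2 hR.le) hs.le)) hp0.le
      rw [Real.mul_rpow (by positivity) (by positivity), ← Real.rpow_mul hA, one_div,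
        inv_mul_cancel₀ hp0.ne', Real.rpow_one, Real.mul_rpow (by positivity) hs.le,
        Real.inv_rpow hR.le] at h2
      calc R ^ N * diffNorm p u ((R⁻¹ * s) • z) ^ p
          ≤ R ^ N * ((R ^ p)⁻¹ * s ^ p * A) := by gcongr
        _ = s ^ p * (R ^ N / R ^ p * A) := by ring
    exact (Real.rpow_le_rpow_iff (diffNorm_nonneg _) (by positivity) hp0).1 h1
  refine hle.trans (le_of_eq ?_)
  rw [← Real.rpow_mul (by positivity), one_div, inv_mul_cancel₀ hp0.ne', Real.rpow_one,
    ENNReal.ofReal_mul (by positivity), ENNReal.ofReal_toReal (hu.dirNormPow_lt_top z).ne]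

/-- The inequality for the inverse dilation is the converse, since the two factors multiply to `1`.
-/
theorem dirNormPow_rescale (hp : 1 ≤ p) (hu : MemS p u) {R : ℝ} (hR : 0 < R)
    (hv : MemS p (rescale R u)) (z : RN N) :
    dirNormPow p (rescale R u) z = ENNReal.ofReal (R ^ N / R ^ p) * dirNormPow p u z := by
  refine le_antisymm (dirNormPow_rescale_le hp hu hR hv z) ?_
  have hRp : 0 < R ^ p := Real.rpow_pos_of_pos hR p
  have h := dirNormPow_rescale_le hp hv (inv_pos.2 hR) (by rwa [rescale_inv_rescale hR]) z
  rw [rescale_inv_rescale hR] at h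
  refine (mul_le_mul_right h _).trans (le_of_eq ?_)
  rw [← mul_assoc, ← ENNReal.ofReal_mul (by positivity), Real.inv_rpow hR.le]
  have : R ^ N / R ^ p * (R⁻¹ ^ N / (R ^ p)⁻¹) = 1 := by
    field_simp
    rw [one_div, ← mul_pow, mul_inv_cancel₀ hR.ne', one_pow]
  rw [this, ENNReal.ofReal_one, one_mul]

theorem dirichletEnergy_rescale (hp : 1 ≤ p) (hu : MemS p u) {R : ℝ} (hR : 0 < R)
    (hv : MemS p (rescale R u)) (μ : Measure (Sph N)) :
    dirichletEnergy p μ (rescale R u) =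
      ENNReal.ofReal (R ^ N / R ^ p) * dirichletEnergy p μ u := by
  rw [dirichletEnergy, dirichletEnergy, ← lintegral_const_mul' _ _ ENNReal.ofReal_ne_top]
  exact lintegral_congr fun σ => dirNormPow_rescale hp hu hR hv σ

theorem MemS.dirichletEnergy_lt_top (hu : MemS p u) (μ : Measure (Sph N)) [IsFiniteMeasure μ] :
    dirichletEnergy p μ u < ⊤ := by
  obtain ⟨K, -, h⟩ := hu.exists_dirNormPow_le
  refine lt_of_le_of_lt (lintegral_mono (g := fun _ => ENNReal.ofReal (K ^ p)) fun σ => ?_) ?_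
  · have := h (σ : RN N)
    rwa [norm_eq_of_mem_sphere, mul_one] at this
  · rw [lintegral_const]
    exact ENNReal.mul_lt_top ENNReal.ofReal_lt_top (measure_lt_top _ _)

end Rescaling

/-! ### Lower bounds for the quotients of a bump -/

section Bump

variable {N : ℕ} {p : ℝ} {u : RN N → ℝ}

/-- Compactly supported functions have difference quotients bounded from below. -/
theorem exists_le_diffNorm_div_rpow (hp : 1 ≤ p) (hu : MemLp u (ENNReal.ofReal p) volume)
    (hc : HasCompactSupport u) (hne : eLpNorm u (ENNReal.ofReal p) volume ≠ 0) :
    ∃ c : ℝ, 0 < c ∧ ∀ z : RN N, z ≠ 0 → c / (1 + ‖z‖ ^ p) ≤ (diffNorm p u z / ‖z‖) ^ p := by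
  have hp0 : 0 < p := by linarith
  obtain ⟨L0, hL0⟩ := hc.isBounded.subset_ball (0 : RN N)
  -- The support lies in the ball of radius `L / 2`, so `u` and its translate have disjoint supports
  -- once `‖z‖ ≥ L`.
  set L : ℝ := 2 * max L0 1 with hLdef
  have hL : 0 < L := by positivity
  set a : ℝ := (eLpNorm u (ENNReal.ofReal p) volume).toReal with ha
  have ha0 : 0 < a := ENNReal.toReal_pos hne hu.2.ne
  have hout : ∀ y : RN N, L / 2 ≤ ‖y‖ → u y = 0 := by
    intro y hy
    by_contra h
    have := hL0 (subset_tsupport u h)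
    rw [mem_ball_zero_iff] at this
    have h1 : L0 ≤ max L0 1 := le_max_left _ _
    rw [hLdef] at hy
    linarith
  have hfar : ∀ z : RN N, L ≤ ‖z‖ → a ≤ diffNorm p u z := by
    intro z hz
    refine ENNReal.toReal_mono (memLp_diff hu z).2.ne (eLpNorm_mono fun x => ?_)
    rcases lt_or_ge ‖x‖ (L / 2) with hx | hx
    · have : u (x + z) = 0 := by
        refine hout _ ?_
        have := norm_sub_norm_le z (-x)
        rw [norm_neg, sub_neg_eq_add, add_comm z x] at this
        linarith
      rw [this, zero_sub, norm_neg]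
    · rw [hout x hx, norm_zero]
      exact norm_nonneg _
  have hnear : ∀ z : RN N, z ≠ 0 → ‖z‖ < L → a / (2 * L) ≤ diffNorm p u z / ‖z‖ := by
    intro z hz hzL
    have hz0 : 0 < ‖z‖ := norm_pos_iff.2 hz
    -- The multiple `n • z` has left the ball of radius `L`, yet `n * ‖z‖ ≤ 2 * L`; subadditivity
    -- carries the far bound back to `z`.
    set n := ⌈L / ‖z‖⌉₊ with hn
    have hn1 : L / ‖z‖ ≤ n := Nat.le_ceil _
    have hn2 : (n : ℝ) < L / ‖z‖ + 1 := Nat.ceil_lt_add_one (by positivity)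
    have hone : 1 ≤ L / ‖z‖ := (one_le_div hz0).2 hzL.le
    have hnpos : (0 : ℝ) < n := by linarith
    have h1 : a ≤ n * diffNorm p u z := by
      refine (hfar (n • z) ?_).trans (diffNorm_nsmul_le hp hu n z)
      rw [← Nat.cast_smul_eq_nsmul ℝ, norm_smul, Real.norm_natCast]
      exact (div_le_iff₀ hz0).1 hn1
    rw [div_le_div_iff₀ (by positivity) hz0]
    have h2 : n * ‖z‖ ≤ 2 * L := by
      have : (n : ℝ) ≤ 2 * (L / ‖z‖) := by linarith
      calc n * ‖z‖ ≤ 2 * (L / ‖z‖) * ‖z‖ := by gcongr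
        _ = 2 * L := by field_simp
    calc a * ‖z‖ ≤ n * diffNorm p u z * ‖z‖ := by gcongr
      _ = diffNorm p u z * (n * ‖z‖) := by ring
      _ ≤ diffNorm p u z * (2 * L) := by
        gcongr
        exact diffNorm_nonneg z
  refine ⟨min ((a / (2 * L)) ^ p) (a ^ p), lt_min (by positivity) (by positivity), fun z hz => ?_⟩
  have hz0 : 0 < ‖z‖ := norm_pos_iff.2 hz
  rcases lt_or_ge ‖z‖ L with hzL | hzL
  · calc min ((a / (2 * L)) ^ p) (a ^ p) / (1 + ‖z‖ ^ p)
        ≤ min ((a / (2 * L)) ^ p) (a ^ p) := by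
          refine div_le_self (by positivity) ?_
          have : 0 ≤ ‖z‖ ^ p := by positivity
          linarith
      _ ≤ (a / (2 * L)) ^ p := min_le_left _ _
      _ ≤ _ := Real.rpow_le_rpow (by positivity) (hnear z hz hzL) hp0.le
  · calc min ((a / (2 * L)) ^ p) (a ^ p) / (1 + ‖z‖ ^ p)
        ≤ a ^ p / ‖z‖ ^ p := by
          gcongr
          · exact min_le_right _ _
          · linarith
      _ = (a / ‖z‖) ^ p := (Real.div_rpow ha0.le hz0.le p).symm
      _ ≤ _ := Real.rpow_le_rpow (by positivity) (by gcongr; exact hfar z hzL) hp0.le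

/-- A weak monotonicity of the quotients, coming from subadditivity; it makes the comparison of two
scales in `tendsto_measure_annulus` one-sided everywhere. -/
theorem diffNorm_nsmul_div_le (hp : 1 ≤ p) (hu : MemLp u (ENNReal.ofReal p) volume) (n : ℕ)
    (z : RN N) : diffNorm p u (n • z) / ‖n • z‖ ≤ diffNorm p u z / ‖z‖ := by
  rcases Nat.eq_zero_or_pos n with rfl | hn
  · simpa using div_nonneg (diffNorm_nonneg z) (norm_nonneg z)
  have hn' : (0 : ℝ) < n := by exact_mod_cast hn
  rw [← Nat.cast_smul_eq_nsmul ℝ n z, norm_smul, Real.norm_natCast, Nat.cast_smul_eq_nsmul]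
  rw [← mul_div_mul_left _ ‖z‖ hn'.ne']
  gcongr
  exact diffNorm_nsmul_le hp hu n z

theorem exists_bump (N : ℕ) (p : ℝ) (hp : 1 ≤ p) :
    ∃ u : RN N → ℝ, ContDiff ℝ ∞ u ∧ HasCompactSupport u ∧
      eLpNorm u (ENNReal.ofReal p) volume ≠ 0 := by
  let f : ContDiffBump (0 : RN N) := ⟨1, 2, one_pos, one_lt_two⟩
  refine ⟨f, f.contDiff, f.hasCompactSupport, fun h => ?_⟩
  rw [eLpNorm_eq_zero_iff f.continuous.aestronglyMeasurable
    (by simpa using (by linarith : 0 < p))] at h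
  have h0 := f.continuous.ae_eq_iff_eq (μ := volume) continuous_zero |>.1 h
  have h1 : f 0 = 1 := f.one_of_mem_closedBall (Metric.mem_closedBall_self f.rIn_pos.le)
  rw [h0] at h1
  simp at h1

end Bump


/-! ### From convergence of energies to concentration -/

section Necessity

variable {N : ℕ} {p : ℝ}

/-- The closed annulus of radii `r` and `M`. -/
def annulus (N : ℕ) (r M : ℝ) : Set (RN N) := {z | r ≤ ‖z‖ ∧ ‖z‖ ≤ M}

theorem isClosed_annulus (r M : ℝ) : IsClosed (annulus N r M) :=
  (isClosed_le continuous_const continuous_norm).inter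
    (isClosed_le continuous_norm continuous_const)

theorem isCompact_annulus (r M : ℝ) : IsCompact (annulus N r M) :=
  (isCompact_closedBall (0 : RN N) M).of_isClosed_subset (isClosed_annulus r M)
    fun z hz => by simpa using hz.2

/-- If the energies converge on `W^{1,p}` or `BV`, then the integrals of rescaled difference
quotients of a fixed test function converge to a limit that does not depend on the scale. -/
theorem tendsto_lintegral_rescaled_quotient (hp : 1 ≤ p) {κ : ℕ → RN N → ℝ}
    (hκ : ∀ k, AEMeasurable (κ k) volume) {μ : Measure (Sph N)}
    (hsup : ∀ u : RN N → ℝ, MemS p u →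
      limsup (fun k => bbmEnergy p (κ k) u) atTop ≤ dirichletEnergy p μ u)
    (hinf : ∀ u : RN N → ℝ, MemS p u →
      dirichletEnergy p μ u ≤ liminf (fun k => bbmEnergy p (κ k) u) atTop)
    {u : RN N → ℝ} (hu : ContDiff ℝ ∞ u) (hc : HasCompactSupport u) {R : ℝ} (hR : 0 < R) :
    Tendsto (fun k => ∫⁻ z, ENNReal.ofReal ((diffNorm p u (R⁻¹ • z) / ‖R⁻¹ • z‖) ^ p)
      ∂(kernelMeasure (κ k))) atTop (𝓝 (dirichletEnergy p μ u)) := by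
  have hRp : 0 < R ^ p := Real.rpow_pos_of_pos hR p
  have huS : MemS p u := memS_of_contDiff hp hu hc
  have hvS : MemS p (rescale R u) :=
    memS_of_contDiff hp (contDiff_rescale R hu) (hasCompactSupport_rescale hR hc)
  -- The energy of the dilate is the rescaled integral times `R ^ N / R ^ p`. Its Dirichlet energy
  -- carries the same factor, which therefore cancels in the limit.
  have hE : ∀ k, bbmEnergy p (κ k) (rescale R u) = ENNReal.ofReal (R ^ N / R ^ p) *
      ∫⁻ z, ENNReal.ofReal ((diffNorm p u (R⁻¹ • z) / ‖R⁻¹ • z‖) ^ p)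
        ∂(kernelMeasure (κ k)) := by
    intro k
    rw [bbmEnergy_eq hp hvS.memLp (hκ k), ← lintegral_const_mul' _ _ ENNReal.ofReal_ne_top]
    refine lintegral_congr fun z => ?_
    rw [diffNorm_rescale_div_rpow hp huS.memLp hR hvS.memLp, ENNReal.ofReal_mul (by positivity)]
  have ht : Tendsto (fun k => bbmEnergy p (κ k) (rescale R u)) atTop
      (𝓝 (dirichletEnergy p μ (rescale R u))) :=
    tendsto_of_le_liminf_of_limsup_le (hinf _ hvS) (hsup _ hvS)
  have hinv : ENNReal.ofReal (R ^ N / R ^ p)⁻¹ * ENNReal.ofReal (R ^ N / R ^ p) = 1 := by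
    rw [← ENNReal.ofReal_mul (by positivity), inv_mul_cancel₀ (by positivity), ENNReal.ofReal_one]
  have ht' := ENNReal.Tendsto.const_mul (a := ENNReal.ofReal (R ^ N / R ^ p)⁻¹) ht
    (Or.inr ENNReal.ofReal_ne_top)
  rw [dirichletEnergy_rescale hp huS hR hvS, ← mul_assoc, hinv, one_mul] at ht'
  refine ht'.congr fun k => ?_
  rw [hE, ← mul_assoc, hinv, one_mul]

/-- Measures for which the rescaled integrals of a difference quotient have the same limit at all
scales concentrate at the origin. -/
theorem tendsto_measure_annulus (hp : 1 ≤ p) {ν : ℕ → Measure (RN N)} {u : RN N → ℝ}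
    (hu : MemLp u (ENNReal.ofReal p) volume) {c : ℝ} (hc : 0 < c)
    (hcu : ∀ z : RN N, z ≠ 0 → c / (1 + ‖z‖ ^ p) ≤ (diffNorm p u z / ‖z‖) ^ p) {E : ℝ≥0∞}
    (hE : E ≠ ⊤)
    (ht : ∀ R : ℝ, 0 < R → Tendsto (fun k => ∫⁻ z,
      ENNReal.ofReal ((diffNorm p u (R⁻¹ • z) / ‖R⁻¹ • z‖) ^ p) ∂(ν k)) atTop (𝓝 E))
    {r M : ℝ} (hr : 0 < r) : Tendsto (fun k => ν k (annulus N r M)) atTop (𝓝 0) := by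
  have hp0 : 0 < p := by linarith
  rcases lt_or_ge M r with hMr | hrM
  · have : annulus N r M = ∅ := by
      ext z
      simp only [annulus, mem_ofPred_eq, mem_empty_iff_false, iff_false]
      rintro ⟨h1, h2⟩
      linarith
    simp [this]
  have hM : 0 < M := hr.trans_le hrM
  set B : ℝ := 2 * (eLpNorm u (ENNReal.ofReal p) volume).toReal with hB
  set c' : ℝ := c / (1 + M ^ p) / 2 with hc'
  have hc'0 : 0 < c' := by positivity
  -- On the annulus the quotient is at least `2 * c'`. Since `d ≤ B`, a large `n` brings the one at
  -- `n • z` down to `c'`, leaving a gap of `c'`.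
  obtain ⟨n, hn⟩ : ∃ n : ℕ, 0 < n ∧ (B / (n * r)) ^ p ≤ c' := by
    have h1 : Tendsto (fun n : ℕ => (B / (n * r)) ^ p) atTop (𝓝 0) := by
      have h2 : Tendsto (fun n : ℕ => B / ((n : ℝ) * r)) atTop (𝓝 0) :=
        (tendsto_natCast_atTop_atTop.atTop_mul_const hr).const_div_atTop B
      simpa [Real.zero_rpow hp0.ne'] using h2.rpow_const (Or.inr hp0.le)
    exact ((eventually_gt_atTop 0).and (h1.eventually (ge_mem_nhds hc'0))).exists
  have hn0 : (0 : ℝ) < n := by exact_mod_cast hn.1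
  have h1 := ht 1 one_pos
  have h2 := ht (n : ℝ)⁻¹ (inv_pos.2 hn0)
  simp only [inv_one, one_smul, inv_inv] at h1 h2
  have hH : ∀ z : RN N, z ∈ annulus N r M →
      c' + (diffNorm p u ((n : ℝ) • z) / ‖(n : ℝ) • z‖) ^ p ≤ (diffNorm p u z / ‖z‖) ^ p := by
    intro z hz
    have hz0 : 0 < ‖z‖ := hr.trans_le hz.1
    have h3 : (diffNorm p u ((n : ℝ) • z) / ‖(n : ℝ) • z‖) ^ p ≤ c' := by
      refine le_trans (Real.rpow_le_rpow (div_nonneg (diffNorm_nonneg _) (norm_nonneg _)) ?_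
        hp0.le) hn.2
      rw [norm_smul, Real.norm_natCast]
      have := hz.1
      exact div_le_div₀ (by positivity) (diffNorm_le_two_mul hp hu _) (by positivity) (by gcongr)
    have h4 : c / (1 + M ^ p) ≤ c / (1 + ‖z‖ ^ p) := by
      have := hz.2
      gcongr
    have h5 := hcu z (norm_pos_iff.1 hz0)
    rw [hc'] at h3 ⊢
    linarith
  have hle : ∀ k, ENNReal.ofReal c' * ν k (annulus N r M) +
      ∫⁻ z, ENNReal.ofReal ((diffNorm p u ((n : ℝ) • z) / ‖(n : ℝ) • z‖) ^ p) ∂(ν k) ≤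
      ∫⁻ z, ENNReal.ofReal ((diffNorm p u z / ‖z‖) ^ p) ∂(ν k) := by
    intro k
    rw [← lintegral_indicator_const (isClosed_annulus r M).measurableSet,
      ← lintegral_add_left (measurable_const.indicator (isClosed_annulus r M).measurableSet)]
    refine lintegral_mono fun z => ?_
    by_cases hz : z ∈ annulus N r M
    · rw [indicator_of_mem hz, ← ENNReal.ofReal_add hc'0.le
        (Real.rpow_nonneg (div_nonneg (diffNorm_nonneg _) (norm_nonneg _)) _)]
      exact ENNReal.ofReal_le_ofReal (hH z hz)
    · rw [indicator_of_notMem hz, zero_add]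
      refine ENNReal.ofReal_le_ofReal (Real.rpow_le_rpow
        (div_nonneg (diffNorm_nonneg _) (norm_nonneg _)) ?_ hp0.le)
      simpa only [Nat.cast_smul_eq_nsmul] using diffNorm_nsmul_div_le hp hu n z
  have hsub := ENNReal.Tendsto.sub h1 h2 (Or.inl hE)
  rw [tsub_self] at hsub
  have hmul : Tendsto (fun k => ENNReal.ofReal c' * ν k (annulus N r M)) atTop (𝓝 0) := by
    refine tendsto_of_tendsto_of_tendsto_of_le_of_le' tendsto_const_nhds hsub
      (Eventually.of_forall fun _ => zero_le) ?_
    -- Subtraction in `ℝ≥0∞` is meaningful here because the subtracted integral is eventually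
    -- finite.
    filter_upwards [h2.eventually (gt_mem_nhds hE.lt_top)] with k hk
    exact ENNReal.le_sub_of_add_le_right hk.ne (hle k)
  have hfin := ENNReal.Tendsto.const_mul (a := (ENNReal.ofReal c')⁻¹) hmul
    (Or.inr (ENNReal.inv_ne_top.2 (by simpa using hc'0)))
  rw [mul_zero] at hfin
  refine hfin.congr fun k => ?_
  rw [← mul_assoc, ENNReal.inv_mul_cancel (by simpa using hc'0) ENNReal.ofReal_ne_top, one_mul]

/-- Measures that concentrate at the origin and whose mass near the origin converges to `α` converge
to `α δ₀`. -/
theorem weakStarTendsto_of_tendsto_measure_annulus {ν : ℕ → Measure (RN N)}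
    (hfin : ∀ k, IsFiniteMeasureOnCompacts (ν k))
    (hann : ∀ r M : ℝ, 0 < r → Tendsto (fun k => ν k (annulus N r M)) atTop (𝓝 0)) {α : ℝ≥0}
    (hα : Tendsto (fun k => ν k (Metric.closedBall 0 1)) atTop (𝓝 (α : ℝ≥0∞))) :
    WeakStarTendsto ν (α • Measure.dirac 0) := by
  intro f hf hc
  rw [integral_smul_nnreal_measure, integral_dirac, NNReal.smul_def, smul_eq_mul]
  obtain ⟨C, hC⟩ := hc.exists_bound_of_continuous hf
  obtain ⟨M, hM⟩ := hc.isBounded.subset_closedBall (0 : RN N)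
  have hC0 : 0 ≤ C := (norm_nonneg _).trans (hC 0)
  have hαr : Tendsto (fun k => (ν k).real (Metric.closedBall 0 1)) atTop (𝓝 (α : ℝ)) := by
    have := (ENNReal.tendsto_toReal ENNReal.coe_ne_top).comp hα
    exact this
  have hannr : ∀ r M : ℝ, 0 < r → Tendsto (fun k => (ν k).real (annulus N r M)) atTop (𝓝 0) := by
    intro r M hr
    have := (ENNReal.tendsto_toReal ENNReal.zero_ne_top).comp (hann r M hr)
    exact this
  -- Compare `f` with `f 0` times the indicator of the unit ball: the difference is at most `ε` for
  -- `‖z‖ ≤ r`, at most `2 * C` up to radius `max M 1`, and zero beyond.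
  have key : ∀ k, ∀ ε r : ℝ, 0 < r → r ≤ 1 → 0 ≤ ε → (∀ z : RN N, ‖z‖ ≤ r → |f z - f 0| ≤ ε) →
      |∫ z, f z ∂(ν k) - (ν k).real (Metric.closedBall 0 1) * f 0| ≤
        ε * (ν k).real (Metric.closedBall 0 1) + 2 * C * (ν k).real (annulus N r (max M 1)) := by
    intro k ε r hr hr1 hε h
    have := hfin k
    have hb : MeasurableSet (Metric.closedBall (0 : RN N) 1) := measurableSet_closedBall
    have ha := (isClosed_annulus (N := N) r (max M 1)).measurableSet
    have hbt : ν k (Metric.closedBall 0 1) ≠ ⊤ := (isCompact_closedBall _ _).measure_lt_top.ne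
    have hat : ν k (annulus N r (max M 1)) ≠ ⊤ := (isCompact_annulus _ _).measure_lt_top.ne
    have hi1 : Integrable f (ν k) := hf.integrable_of_hasCompactSupport hc
    have hi2 : ∀ a : ℝ, Integrable ((Metric.closedBall (0 : RN N) 1).indicator fun _ => a) (ν k) :=
      fun a => (integrable_indicator_iff hb).2 (integrableOn_const hbt)
    have hi3 : ∀ a : ℝ, Integrable ((annulus N r (max M 1)).indicator fun _ => a) (ν k) :=
      fun a => (integrable_indicator_iff ha).2 (integrableOn_const hat)
    have e1 : ∀ a : ℝ, ∫ z, (Metric.closedBall (0 : RN N) 1).indicator (fun _ => a) z ∂(ν k) =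
        (ν k).real (Metric.closedBall 0 1) * a := fun a => by
      rw [integral_indicator_const _ hb, smul_eq_mul]
    have e2 : ∀ a : ℝ, ∫ z, (annulus N r (max M 1)).indicator (fun _ => a) z ∂(ν k) =
        (ν k).real (annulus N r (max M 1)) * a := fun a => by
      rw [integral_indicator_const _ ha, smul_eq_mul]
    rw [← e1, ← integral_sub hi1 (hi2 _), mul_comm ε, mul_comm (2 * C), ← e1, ← e2,
      ← integral_add (hi2 _) (hi3 _), ← Real.norm_eq_abs]
    refine norm_integral_le_of_norm_le ((hi2 _).add (hi3 _)) (Eventually.of_forall fun z => ?_)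
    have hz := hC z
    have h0 := hC 0
    rw [Real.norm_eq_abs] at hz h0 ⊢
    rcases le_or_gt ‖z‖ r with hzr | hzr
    · have hzb : z ∈ Metric.closedBall (0 : RN N) 1 := by simpa using hzr.trans hr1
      rw [indicator_of_mem hzb, indicator_of_mem hzb]
      refine (h z hzr).trans (le_add_of_nonneg_right (indicator_nonneg (fun _ _ => by positivity) _))
    · by_cases hzM : ‖z‖ ≤ max M 1
      · have hza : z ∈ annulus N r (max M 1) := ⟨hzr.le, hzM⟩
        rw [indicator_of_mem hza]
        have h1 : 0 ≤ (Metric.closedBall (0 : RN N) 1).indicator (fun _ => ε) z :=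
          indicator_nonneg (fun _ _ => hε) _
        have h2 : |(Metric.closedBall (0 : RN N) 1).indicator (fun _ => f 0) z| ≤ C := by
          by_cases hzb : z ∈ Metric.closedBall (0 : RN N) 1
          · rwa [indicator_of_mem hzb]
          · rw [indicator_of_notMem hzb]; simpa using hC0
        have := abs_sub (f z) ((Metric.closedBall (0 : RN N) 1).indicator (fun _ => f 0) z)
        linarith
      · have hzM' := not_le.1 hzM
        have hfz : f z = 0 := by
          by_contra hne
          have := hM (subset_tsupport f hne)
          rw [mem_closedBall_zero_iff] at this
          exact hzM (this.trans (le_max_left _ _))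
        have hzb : z ∉ Metric.closedBall (0 : RN N) 1 := by
          simpa using (le_max_right _ _).trans_lt hzM'
        have hza : z ∉ annulus N r (max M 1) := fun hz => hzM hz.2
        simp [hfz, hzb, hza]
  have hdiff : Tendsto (fun k => ∫ z, f z ∂(ν k) - (ν k).real (Metric.closedBall 0 1) * f 0) atTop
      (𝓝 0) := by
    rw [Metric.tendsto_nhds]
    intro ε hε
    set ε' : ℝ := ε / (2 * (α + 1)) with hε'
    have hε'0 : 0 < ε' := by positivity
    obtain ⟨r0, hr0, hr⟩ := Metric.continuousAt_iff.1 (hf.continuousAt (x := 0)) ε' hε'0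
    set r := min (r0 / 2) 1 with hrdef
    have hrpos : 0 < r := by positivity
    have hlim := (hαr.const_mul ε').add ((hannr r (max M 1) hrpos).const_mul (2 * C))
    have hlt : ε' * α + 2 * C * 0 < ε := by
      have hα0 : (0 : ℝ) ≤ α := α.2
      rw [mul_zero, add_zero, hε', div_mul_eq_mul_div, div_lt_iff₀ (by positivity)]
      nlinarith
    filter_upwards [hlim.eventually (gt_mem_nhds hlt)] with k hk
    rw [Real.dist_eq, sub_zero]
    refine (key k ε' r hrpos (min_le_right _ _) hε'0.le fun z hz => ?_).trans_lt hk
    have h1 : dist z 0 < r0 := by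
      rw [dist_zero_right]
      exact (hz.trans (min_le_left _ _)).trans_lt (half_lt_self hr0)
    exact (Real.dist_eq _ _ ▸ hr h1).le
  have := hdiff.add (hαr.mul_const (f 0))
  simpa using this

/-- The quotient of one bump, evaluated at `z / R`, dominates `c R^p / (R^p + |z|^p)` for every `R`
at once; this gives the tail bound with a constant independent of `R`. A subsequence is extracted
only to make the mass of the unit ball converge. -/
theorem exists_subseq_of_energy_convergence (hN : 0 < N) (hp : 1 ≤ p) {κ : ℕ → RN N → ℝ}
    (hκ : ∀ k, LocallyIntegrable (κ k) volume) {μ : Measure (Sph N)} [IsFiniteMeasure μ]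
    (hsup : ∀ u : RN N → ℝ, MemS p u →
      limsup (fun k => bbmEnergy p (κ k) u) atTop ≤ dirichletEnergy p μ u)
    (hinf : ∀ u : RN N → ℝ, MemS p u →
      dirichletEnergy p μ u ≤ liminf (fun k => bbmEnergy p (κ k) u) atTop) :
    ∃ φ : ℕ → ℕ, StrictMono φ ∧
      (⨆ (R : ℝ) (_ : 0 < R), limsup (fun k => ENNReal.ofReal (R ^ p) *
        ∫⁻ z, ENNReal.ofReal (κ (φ k) z / (R ^ p + ‖z‖ ^ p))) atTop) < ⊤ ∧
      ∃ α : ℝ≥0, WeakStarTendsto (fun k => kernelMeasure (κ (φ k))) (α • Measure.dirac 0) := by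
  have hp0 : 0 < p := by linarith
  have hκm : ∀ k, AEMeasurable (κ k) volume := fun k => (hκ k).aestronglyMeasurable.aemeasurable
  obtain ⟨u, hu, huc, hne⟩ := exists_bump N p hp
  have huS : MemS p u := memS_of_contDiff hp hu huc
  obtain ⟨c, hc, hcu⟩ := exists_le_diffNorm_div_rpow hp huS.memLp huc hne
  set E := dirichletEnergy p μ u
  have hE : E ≠ ⊤ := (huS.dirichletEnergy_lt_top μ).ne
  have ht := fun (R : ℝ) (hR : 0 < R) =>
    tendsto_lintegral_rescaled_quotient hp hκm hsup hinf hu huc hR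
  have hann := fun (r M : ℝ) (hr : 0 < r) => tendsto_measure_annulus hp huS.memLp hc hcu hE ht
    (M := M) hr
  have hbound : ∀ (k : ℕ) (R : ℝ), 0 < R →
      ∫⁻ z, ENNReal.ofReal (R ^ p / (R ^ p + ‖z‖ ^ p)) ∂(kernelMeasure (κ k)) ≤
        ENNReal.ofReal c⁻¹ * ∫⁻ z, ENNReal.ofReal ((diffNorm p u (R⁻¹ • z) / ‖R⁻¹ • z‖) ^ p)
          ∂(kernelMeasure (κ k)) := by
    intro k R hR
    have hRp : 0 < R ^ p := Real.rpow_pos_of_pos hR p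
    rw [← lintegral_const_mul' _ _ ENNReal.ofReal_ne_top]
    refine lintegral_mono_ae ?_
    filter_upwards [ae_ne_zero_kernelMeasure (κ := κ k) hN] with z hz
    rw [← ENNReal.ofReal_mul (by positivity)]
    refine ENNReal.ofReal_le_ofReal ?_
    have h1 := hcu (R⁻¹ • z) (smul_ne_zero (inv_ne_zero hR.ne') hz)
    rw [le_inv_mul_iff₀ hc]
    refine le_trans (le_of_eq ?_) h1
    rw [norm_smul, norm_inv, Real.norm_eq_abs, abs_of_pos hR,
      Real.mul_rpow (by positivity) (norm_nonneg _), Real.inv_rpow hR.le]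
    field_simp
  -- On the unit ball `1 ≤ 2 / (1 + ‖z‖ ^ p)`, so the tail bound at `R = 1` controls the mass.
  have hmass : ∀ k, kernelMeasure (κ k) (Metric.closedBall 0 1) ≤
      ENNReal.ofReal 2 * (ENNReal.ofReal c⁻¹ * ∫⁻ z,
        ENNReal.ofReal ((diffNorm p u ((1 : ℝ)⁻¹ • z) / ‖(1 : ℝ)⁻¹ • z‖) ^ p)
          ∂(kernelMeasure (κ k))) := by
    intro k
    refine le_trans ?_ (mul_le_mul_right (hbound k 1 one_pos) _)
    rw [← lintegral_const_mul' _ _ ENNReal.ofReal_ne_top,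
      ← lintegral_indicator_one measurableSet_closedBall]
    refine lintegral_mono fun z => ?_
    by_cases hz : z ∈ Metric.closedBall (0 : RN N) 1
    · rw [indicator_of_mem hz, Pi.one_apply, Real.one_rpow,
        ← ENNReal.ofReal_mul (by norm_num), ← ENNReal.ofReal_one]
      refine ENNReal.ofReal_le_ofReal ?_
      rw [mem_closedBall_zero_iff] at hz
      have h1 : ‖z‖ ^ p ≤ 1 := Real.rpow_le_one (norm_nonneg _) hz hp0.le
      have h2 : 0 ≤ ‖z‖ ^ p := by positivity
      rw [mul_one_div, one_le_div (by positivity)]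
      linarith
    · rw [indicator_of_notMem hz]
      exact zero_le
  obtain ⟨a, φ, hφ, ha⟩ := CompactSpace.tendsto_subseq
    (fun k => kernelMeasure (κ k) (Metric.closedBall 0 1))
  have htφ := fun (R : ℝ) (hR : 0 < R) => (ht R hR).comp hφ.tendsto_atTop
  have hatop : a ≠ ⊤ := by
    have hlim := ENNReal.Tendsto.const_mul (a := ENNReal.ofReal 2) (ENNReal.Tendsto.const_mul
      (a := ENNReal.ofReal c⁻¹) (htφ 1 one_pos) (Or.inr ENNReal.ofReal_ne_top))
      (Or.inr ENNReal.ofReal_ne_top)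
    refine ne_top_of_le_ne_top ?_ (le_of_tendsto_of_tendsto' ha hlim fun k => hmass (φ k))
    exact ENNReal.mul_ne_top ENNReal.ofReal_ne_top (ENNReal.mul_ne_top ENNReal.ofReal_ne_top hE)
  refine ⟨φ, hφ, ?_, a.toNNReal, ?_⟩
  · refine lt_of_le_of_lt (b := ENNReal.ofReal c⁻¹ * E) (iSup₂_le fun R hR => ?_)
      (ENNReal.mul_lt_top ENNReal.ofReal_lt_top hE.lt_top)
    have hlim := ENNReal.Tendsto.const_mul (a := ENNReal.ofReal c⁻¹) (htφ R hR)
      (Or.inr ENNReal.ofReal_ne_top)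
    rw [← hlim.limsup_eq]
    refine limsup_le_limsup (Eventually.of_forall fun k => ?_)
    simp only [ofReal_rpow_mul_lintegral_kernel (hκm _) p hR]
    exact hbound (φ k) R hR
  · refine weakStarTendsto_of_tendsto_measure_annulus
      (fun k => isFiniteMeasureOnCompacts_kernelMeasure (hκ _))
      (fun r M hr => (hann r M hr).comp hφ.tendsto_atTop) ?_
    rw [ENNReal.coe_toNNReal hatop]
    exact ha

end Necessity


/-! ### Consequences of weak-star convergence to a point mass -/

section Concentration

variable {N : ℕ} {ν : ℕ → Measure (RN N)} {α : ℝ≥0}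

theorem WeakStarTendsto.tendsto_integral_dirac (h : WeakStarTendsto ν (α • Measure.dirac 0))
    {f : RN N → ℝ} (hf : Continuous f) (hc : HasCompactSupport f) :
    Tendsto (fun k => ∫ z, f z ∂(ν k)) atTop (𝓝 (α * f 0)) := by
  have := h f hf hc
  rwa [integral_smul_nnreal_measure, integral_dirac, NNReal.smul_def, smul_eq_mul] at this

theorem hasCompactSupport_of_eq_zero_of_lt_norm {f : RN N → ℝ} (M : ℝ)
    (h : ∀ z, M < ‖z‖ → f z = 0) : HasCompactSupport f := by
  refine HasCompactSupport.of_support_subset_isCompact (isCompact_closedBall (0 : RN N) M) ?_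
  intro z hz
  rw [mem_closedBall_zero_iff]
  by_contra hlt
  exact hz (h z (not_le.1 hlt))

theorem measureReal_le_integral_of_one_le {m : Measure (RN N)} {f : RN N → ℝ} (hf : Integrable f m)
    (h0 : ∀ z, 0 ≤ f z) {s : Set (RN N)} (hs : MeasurableSet s) (hms : m s ≠ ⊤)
    (h1 : ∀ z ∈ s, 1 ≤ f z) : m.real s ≤ ∫ z, f z ∂m := by
  have e : ∫ z, s.indicator (fun _ => (1 : ℝ)) z ∂m = m.real s := by
    rw [integral_indicator_const _ hs, smul_eq_mul, mul_one]
  rw [← e]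
  refine integral_mono ((integrable_indicator_iff hs).2 (integrableOn_const hms)) hf fun z => ?_
  by_cases hz : z ∈ s
  · simpa [hz] using h1 z hz
  · simpa [hz] using h0 z

theorem WeakStarTendsto.tendsto_annulus (hfin : ∀ k, IsFiniteMeasureOnCompacts (ν k))
    (h : WeakStarTendsto ν (α • Measure.dirac 0)) {r : ℝ} (hr : 0 < r) (M : ℝ) :
    Tendsto (fun k => ν k (annulus N r M)) atTop (𝓝 0) := by
  -- A continuous cutoff that is `1` on the annulus and `0` at the origin, with compact support.
  set f : RN N → ℝ := fun z =>
    max 0 (min 1 (2 / r * ‖z‖ - 1)) * max 0 (min 1 (M + 1 - ‖z‖)) with hf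
  have hfc : Continuous f := by fun_prop
  have hfs : HasCompactSupport f := by
    refine hasCompactSupport_of_eq_zero_of_lt_norm (M + 1) fun z hz => ?_
    have : max 0 (min 1 (M + 1 - ‖z‖)) = 0 :=
      max_eq_left ((min_le_right _ _).trans (by linarith))
    rw [hf]
    simp only [this, mul_zero]
  have hlim := h.tendsto_integral_dirac hfc hfs
  have hf0 : f 0 = 0 := by simp [hf]
  rw [hf0, mul_zero] at hlim
  have hreal : Tendsto (fun k => (ν k).real (annulus N r M)) atTop (𝓝 0) := by
    refine squeeze_zero (fun _ => measureReal_nonneg) (fun k => ?_) hlim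
    have := hfin k
    refine measureReal_le_integral_of_one_le (hfc.integrable_of_hasCompactSupport hfs)
      (fun z => mul_nonneg (le_max_left _ _) (le_max_left _ _))
      (isClosed_annulus r M).measurableSet (isCompact_annulus r M).measure_lt_top.ne ?_
    rintro z ⟨hz1, hz2⟩
    have h1 : (1 : ℝ) ≤ 2 / r * ‖z‖ - 1 := by
      have : 2 / r * r ≤ 2 / r * ‖z‖ := by gcongr
      rw [div_mul_cancel₀ _ hr.ne'] at this
      linarith
    have h2 : (1 : ℝ) ≤ M + 1 - ‖z‖ := by linarith
    rw [hf]
    simp only [min_eq_left h1, min_eq_left h2]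
    norm_num
  have := ENNReal.tendsto_ofReal hreal
  rw [ENNReal.ofReal_zero] at this
  refine this.congr fun k => ?_
  have := hfin k
  exact ofReal_measureReal (isCompact_annulus r M).measure_lt_top.ne

theorem WeakStarTendsto.tendsto_ball (hfin : ∀ k, IsFiniteMeasureOnCompacts (ν k))
    (h : WeakStarTendsto ν (α • Measure.dirac 0)) :
    Tendsto (fun k => ν k (Metric.ball 0 1)) atTop (𝓝 (α : ℝ≥0∞)) := by
  -- This cutoff lies between the indicator of the unit ball and that indicator plus the one of the
  -- annulus of radii `1` and `2`, whose mass vanishes.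
  set f : RN N → ℝ := fun z => max 0 (min 1 (2 - ‖z‖)) with hf
  have hfc : Continuous f := by fun_prop
  have hfs : HasCompactSupport f :=
    hasCompactSupport_of_eq_zero_of_lt_norm 2 fun z hz =>
      max_eq_left ((min_le_right _ _).trans (by linarith))
  have hlim := h.tendsto_integral_dirac hfc hfs
  have hf0 : f 0 = 1 := by simp [hf]
  rw [hf0, mul_one] at hlim
  have hann : Tendsto (fun k => (ν k).real (annulus N 1 2)) atTop (𝓝 0) :=
    (ENNReal.tendsto_toReal ENNReal.zero_ne_top).comp (h.tendsto_annulus hfin one_pos 2)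
  have hbt : ∀ k, ν k (Metric.ball 0 1) ≠ ⊤ := fun k => by
    have := hfin k
    exact ((measure_mono Metric.ball_subset_closedBall).trans_lt
      (isCompact_closedBall (0 : RN N) 1).measure_lt_top).ne
  have hreal : Tendsto (fun k => (ν k).real (Metric.ball 0 1)) atTop (𝓝 (α : ℝ)) := by
    have hlow := hlim.sub hann
    rw [sub_zero] at hlow
    refine tendsto_of_tendsto_of_tendsto_of_le_of_le hlow hlim (fun k => ?_) fun k => ?_
    · have := hfin k
      have hat : ν k (annulus N 1 2) ≠ ⊤ := (isCompact_annulus _ _).measure_lt_top.ne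
      have ha := (isClosed_annulus (N := N) 1 2).measurableSet
      have hb : MeasurableSet (Metric.ball (0 : RN N) 1) := measurableSet_ball
      have i1 : Integrable ((Metric.ball (0 : RN N) 1).indicator fun _ => (1 : ℝ)) (ν k) :=
        (integrable_indicator_iff hb).2 (integrableOn_const (hbt k))
      have i2 : Integrable ((annulus N 1 2).indicator fun _ => (1 : ℝ)) (ν k) :=
        (integrable_indicator_iff ha).2 (integrableOn_const hat)
      have e : (ν k).real (Metric.ball 0 1) + (ν k).real (annulus N 1 2) =
          ∫ z, ((Metric.ball (0 : RN N) 1).indicator (fun _ => (1 : ℝ)) z +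
            (annulus N 1 2).indicator (fun _ => (1 : ℝ)) z) ∂(ν k) := by
        rw [integral_add i1 i2, integral_indicator_const _ hb, integral_indicator_const _ ha]
        simp
      rw [sub_le_iff_le_add, e]
      refine integral_mono (hfc.integrable_of_hasCompactSupport hfs) (i1.add i2) fun z => ?_
      have hle1 : f z ≤ 1 := max_le zero_le_one (min_le_left _ _)
      rcases lt_or_ge ‖z‖ 1 with hz | hz
      · have hzb : z ∈ Metric.ball (0 : RN N) 1 := by simpa using hz
        simp only [indicator_of_mem hzb]
        exact hle1.trans (le_add_of_nonneg_right (indicator_nonneg (fun _ _ => zero_le_one) _))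
      · rcases le_or_gt ‖z‖ 2 with hz2 | hz2
        · have hza : z ∈ annulus N 1 2 := ⟨hz, hz2⟩
          simp only [indicator_of_mem hza]
          exact hle1.trans (le_add_of_nonneg_left (indicator_nonneg (fun _ _ => zero_le_one) _))
        · have : f z = 0 := max_eq_left ((min_le_right _ _).trans (by linarith))
          rw [this]
          exact add_nonneg (indicator_nonneg (fun _ _ => zero_le_one) _)
            (indicator_nonneg (fun _ _ => zero_le_one) _)
    · have := hfin k
      refine measureReal_le_integral_of_one_le (hfc.integrable_of_hasCompactSupport hfs)
        (fun z => le_max_left _ _) measurableSet_ball (hbt k) fun z hz => ?_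
      rw [mem_ball_zero_iff] at hz
      exact (le_min le_rfl (by linarith)).trans (le_max_right _ _)
  have := ENNReal.tendsto_ofReal hreal
  rw [ENNReal.ofReal_coe_nnreal] at this
  exact this.congr fun k => ofReal_measureReal (hbt k)

end Concentration

/-! ### Limit distribution of directions -/

section Directions

variable {N : ℕ}

/-- The direction `z / ‖z‖` of a vector, with a default value at `0`. -/
def direction (e : Sph N) (z : RN N) : Sph N :=
  open scoped Classical in
  ⟨if z = 0 then (e : RN N) else ‖z‖⁻¹ • z, by
    split_ifs with h
    · exact e.2
    · rw [mem_sphere_zero_iff_norm, norm_smul, norm_inv, norm_norm,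
        inv_mul_cancel₀ (norm_ne_zero_iff.2 h)]⟩

theorem norm_smul_direction (e : Sph N) {z : RN N} (hz : z ≠ 0) :
    ‖z‖ • (direction e z : RN N) = z := by
  simp [direction, hz, smul_smul]

theorem measurable_direction (e : Sph N) : Measurable (direction e) :=
  (Measurable.ite (measurableSet_singleton 0) measurable_const
    (measurable_norm.inv.smul measurable_id)).subtype_mk

/-- Compactness of the distributions of directions of measures with converging mass. -/
theorem exists_subseq_tendsto_direction (e : Sph N) {ν : ℕ → Measure (RN N)} {α : ℝ≥0}
    (hfin : ∀ k, IsFiniteMeasureOnCompacts (ν k))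
    (hα : Tendsto (fun k => ν k (Metric.ball 0 1)) atTop (𝓝 (α : ℝ≥0∞))) :
    ∃ φ : ℕ → ℕ, StrictMono φ ∧ ∃ μ : Measure (Sph N), IsFiniteMeasure μ ∧
      ∀ g : Sph N → ℝ, Continuous g →
        Tendsto (fun k => ∫⁻ z in Metric.ball 0 1, ENNReal.ofReal (g (direction e z)) ∂(ν (φ k)))
          atTop (𝓝 (∫⁻ σ, ENNReal.ofReal (g σ) ∂μ)) := by
  have : Nonempty (Sph N) := ⟨e⟩
  have hbf : ∀ k, IsFiniteMeasure ((ν k).restrict (Metric.ball 0 1)) := fun k => by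
    have := hfin k
    refine ⟨?_⟩
    rw [Measure.restrict_apply_univ]
    exact (measure_mono Metric.ball_subset_closedBall).trans_lt
      (isCompact_closedBall (0 : RN N) 1).measure_lt_top
  let m : ℕ → FiniteMeasure (Sph N) := fun k =>
    ⟨((ν k).restrict (Metric.ball 0 1)).map (direction e), inferInstance⟩
  have hmass : ∀ k, ((m k).mass : ℝ≥0∞) = ν k (Metric.ball 0 1) := by
    intro k
    rw [FiniteMeasure.ennreal_mass]
    change ((ν k).restrict (Metric.ball 0 1)).map (direction e) univ = _
    rw [Measure.map_apply (measurable_direction e) MeasurableSet.univ, preimage_univ,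
      Measure.restrict_apply_univ]
  -- Probability measures on the compact sphere are sequentially compact, and `μ` is `α` times the
  -- limit. A zero measure normalises to an arbitrary probability measure, which is harmless because
  -- its mass multiplies it back to zero.
  obtain ⟨P, φ, hφ, hP⟩ := CompactSpace.tendsto_subseq (fun k => (m k).normalize)
  refine ⟨φ, hφ, α • (P : Measure (Sph N)), inferInstance, fun g hg => ?_⟩
  have hint := (ProbabilityMeasure.tendsto_iff_forall_lintegral_tendsto.1 hP)
    (BoundedContinuousFunction.mkOfCompact ⟨fun σ => (g σ).toNNReal, continuous_real_toNNReal.comp hg⟩)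
  simp only [BoundedContinuousFunction.mkOfCompact_apply, ContinuousMap.coe_mk] at hint
  have hprod := ENNReal.Tendsto.mul (hα.comp hφ.tendsto_atTop) (Or.inr (ne_of_lt ?_)) hint
    (Or.inr ENNReal.coe_ne_top)
  · rw [lintegral_smul_measure]
    refine hprod.congr fun k => ?_
    have e1 : ∫⁻ z in Metric.ball 0 1, ENNReal.ofReal (g (direction e z)) ∂(ν (φ k)) =
        ∫⁻ σ, ENNReal.ofReal (g σ) ∂(m (φ k) : Measure (Sph N)) :=
      (lintegral_map hg.measurable.ennreal_ofReal (measurable_direction e)).symm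
    rw [e1, FiniteMeasure.self_eq_mass_smul_normalize (m (φ k)), FiniteMeasure.toMeasure_smul,
      lintegral_smul_measure]
    change ν (φ k) (Metric.ball 0 1) * _ = ((m (φ k)).mass : ℝ≥0∞) * _
    rw [hmass]
    rfl
  · obtain ⟨C, hC⟩ := isCompact_univ.exists_bound_of_continuousOn hg.continuousOn
    refine lt_of_le_of_lt (lintegral_mono (g := fun _ => ENNReal.ofReal C) fun σ => ?_) ?_
    · exact ENNReal.ofReal_le_ofReal ((le_abs_self _).trans (hC σ (mem_univ _)))
    · rw [lintegral_const]
      exact ENNReal.mul_lt_top ENNReal.ofReal_lt_top (measure_lt_top _ _)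

/-- The part of the unit ball outside the ball of radius `η` lies in an annulus, where `g` is
bounded and the mass vanishes. Thus the limit sees only arbitrarily small displacements. -/
theorem le_liminf_lintegral_direction (e : Sph N) {ν : ℕ → Measure (RN N)} {L : ℝ≥0∞}
    (hann : ∀ r M : ℝ, 0 < r → Tendsto (fun k => ν k (annulus N r M)) atTop (𝓝 0))
    {g : Sph N → ℝ} (hg : Continuous g)
    (ht : Tendsto (fun k => ∫⁻ z in Metric.ball 0 1, ENNReal.ofReal (g (direction e z)) ∂(ν k))
      atTop (𝓝 L)) {η : ℝ} (hη : 0 < η) :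
    L ≤ liminf (fun k => ∫⁻ z in Metric.ball 0 η, ENNReal.ofReal (g (direction e z)) ∂(ν k))
      atTop := by
  obtain ⟨C, hC⟩ := isCompact_univ.exists_bound_of_continuousOn hg.continuousOn
  have hsub := ENNReal.Tendsto.sub ht (ENNReal.Tendsto.const_mul (a := ENNReal.ofReal C)
    (hann η 1 hη) (Or.inr ENNReal.ofReal_ne_top)) (Or.inr (by simp))
  rw [mul_zero, tsub_zero] at hsub
  rw [← hsub.liminf_eq]
  refine liminf_le_liminf (Eventually.of_forall fun k => ?_)
  rw [tsub_le_iff_right]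
  have hsubset : Metric.ball (0 : RN N) 1 ⊆ Metric.ball 0 η ∪ annulus N η 1 := by
    intro z hz
    rw [mem_ball_zero_iff] at hz
    rcases lt_or_ge ‖z‖ η with h | h
    · exact Or.inl (by simpa using h)
    · exact Or.inr ⟨h, hz.le⟩
  refine (lintegral_mono_set hsubset).trans ((lintegral_union_le _ _ _).trans ?_)
  gcongr
  rw [← setLIntegral_const]
  refine lintegral_mono fun z => ?_
  exact ENNReal.ofReal_le_ofReal ((le_abs_self _).trans (hC _ (mem_univ _)))

end Directions


/-! ### From concentration to convergence of energies -/

section Sufficiency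

variable {N : ℕ} {p : ℝ} {u : RN N → ℝ}

/-- Along `s • z = s • w + s • (z - w)` the second displacement costs at most `K s ‖z - w‖`. The
resulting continuity in the direction makes the norm a test function for weak convergence on the
sphere. -/
theorem MemS.rpow_toReal_dirNormPow_le_add (hp : 1 ≤ p) (hu : MemS p u) {K : ℝ} (hK : 0 ≤ K)
    (hKu : ∀ z : RN N, diffNorm p u z ≤ K * ‖z‖) (z w : RN N) :
    (dirNormPow p u z).toReal ^ (1 / p) ≤ (dirNormPow p u w).toReal ^ (1 / p) + K * ‖z - w‖ := by
  have hp0 : 0 < p := by linarith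
  have h : dirNormPow p u z ≤
      ENNReal.ofReal (((dirNormPow p u w).toReal ^ (1 / p) + K * ‖z - w‖) ^ p) := by
    refine hu.dirNormPow_le hp (by positivity) fun s hs => ?_
    have e : s • z = s • w + s • (z - w) := by rw [← smul_add]; simp
    rw [e]
    refine (diffNorm_add_le hp hu.memLp _ _).trans ?_
    have h1 := hu.diffNorm_smul_le hp w hs.le
    have h2 := hKu (s • (z - w))
    rw [norm_smul, Real.norm_eq_abs, abs_of_pos hs] at h2
    linarith
  have h2 := Real.rpow_le_rpow ENNReal.toReal_nonneg
    (ENNReal.toReal_le_of_le_ofReal (by positivity) h) (by positivity : 0 ≤ 1 / p)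
  rwa [← Real.rpow_mul (by positivity), mul_one_div_cancel hp0.ne', Real.rpow_one] at h2

theorem MemS.continuous_toReal_dirNormPow (hp : 1 ≤ p) (hu : MemS p u) :
    Continuous fun z : RN N => (dirNormPow p u z).toReal := by
  have hp0 : 0 < p := by linarith
  obtain ⟨K, hK, hKu⟩ := hu.exists_diffNorm_le hp
  have hlip : LipschitzWith K.toNNReal
      fun z : RN N => (dirNormPow p u z).toReal ^ (1 / p) := by
    refine LipschitzWith.of_le_add_mul _ fun z w => ?_
    rw [Real.coe_toNNReal _ hK, dist_eq_norm]
    exact hu.rpow_toReal_dirNormPow_le_add hp hK hKu z w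
  have := hlip.continuous.rpow_const (p := p) fun _ => Or.inr hp0.le
  refine this.congr fun z => ?_
  rw [← Real.rpow_mul ENNReal.toReal_nonneg, one_div, inv_mul_cancel₀ hp0.ne', Real.rpow_one]

theorem continuous_diffNorm (hp : 1 ≤ p) (hu : MemLp u (ENNReal.ofReal p) volume) {K : ℝ}
    (hK : 0 ≤ K) (hKu : ∀ z : RN N, diffNorm p u z ≤ K * ‖z‖) : Continuous (diffNorm p u) := by
  have hlip : LipschitzWith K.toNNReal (diffNorm p u) := by
    refine LipschitzWith.of_le_add_mul _ fun z w => ?_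
    rw [Real.coe_toNNReal _ hK, dist_eq_norm]
    have h := diffNorm_add_le hp hu w (z - w)
    rw [add_sub_cancel] at h
    linarith [hKu (z - w)]
  exact hlip.continuous

/-- Three regions: in the unit ball the quotient is at most the directional norm, on `1 ≤ ‖z‖ ≤ R`
it is at most `K` and the mass vanishes, and beyond `R` the difference is at most `B`. The last
contribution is `O(R^{-p})` uniformly in `k`, so `R → ∞` at the end. -/
theorem limsup_bbmEnergy_le (hp : 1 ≤ p) (e : Sph N) {κ : ℕ → RN N → ℝ}
    (hκ : ∀ k, AEMeasurable (κ k) volume)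
    (hann : ∀ r M : ℝ, 0 < r →
      Tendsto (fun k => kernelMeasure (κ k) (annulus N r M)) atTop (𝓝 0))
    {C : ℝ≥0∞} (hC : C ≠ ⊤)
    (htail : ∀ R : ℝ, 0 < R → limsup (fun k => ∫⁻ z, ENNReal.ofReal (R ^ p / (R ^ p + ‖z‖ ^ p))
      ∂(kernelMeasure (κ k))) atTop ≤ C) (hu : MemS p u) {L : ℝ≥0∞}
    (ht : Tendsto (fun k => ∫⁻ z in Metric.ball 0 1,
      ENNReal.ofReal (dirNormPow p u (direction e z)).toReal ∂(kernelMeasure (κ k))) atTop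
      (𝓝 L)) :
    limsup (fun k => bbmEnergy p (κ k) u) atTop ≤ L := by
  have hp0 : 0 < p := by linarith
  obtain ⟨K, hK, hKu⟩ := hu.exists_diffNorm_le hp
  set B : ℝ := 2 * (eLpNorm u (ENNReal.ofReal p) volume).toReal with hB
  have hB0 : 0 ≤ B := by positivity
  have hpt : ∀ R : ℝ, 0 < R → ∀ z : RN N, ENNReal.ofReal ((diffNorm p u z / ‖z‖) ^ p) ≤
      ((Metric.ball (0 : RN N) 1).indicator
        (fun z => ENNReal.ofReal (dirNormPow p u (direction e z)).toReal) z +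
      (annulus N 1 R).indicator (fun _ => ENNReal.ofReal (K ^ p)) z) +
      ENNReal.ofReal (B ^ p * 2 / R ^ p) * ENNReal.ofReal (R ^ p / (R ^ p + ‖z‖ ^ p)) := by
    intro R hR z
    have hRp : 0 < R ^ p := Real.rpow_pos_of_pos hR p
    rcases eq_or_ne z 0 with rfl | hz
    · simp [Real.zero_rpow hp0.ne']
    have hz0 : 0 < ‖z‖ := norm_pos_iff.2 hz
    rcases lt_or_ge ‖z‖ 1 with hz1 | hz1
    · have hzb : z ∈ Metric.ball (0 : RN N) 1 := by simpa using hz1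
      rw [indicator_of_mem hzb, ENNReal.ofReal_toReal (hu.dirNormPow_lt_top _).ne, add_assoc]
      refine le_trans ?_ le_self_add
      have := hu.ofReal_div_rpow_le hp (direction e z : RN N) hz0
      rwa [norm_smul_direction e hz] at this
    · rcases le_or_gt ‖z‖ R with hzR | hzR
      · have hza : z ∈ annulus N 1 R := ⟨hz1, hzR⟩
        rw [indicator_of_mem hza]
        refine le_trans (ENNReal.ofReal_le_ofReal ?_) (le_add_self.trans le_self_add)
        refine Real.rpow_le_rpow (div_nonneg (diffNorm_nonneg _) hz0.le) ?_ hp0.le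
        exact (div_le_iff₀ hz0).2 (hKu z)
      -- Here `R ^ p + ‖z‖ ^ p ≤ 2 * ‖z‖ ^ p`, which accounts for the factor `2`.
      · refine le_trans ?_ le_add_self
        rw [← ENNReal.ofReal_mul (by positivity)]
        refine ENNReal.ofReal_le_ofReal ?_
        have h1 : (diffNorm p u z / ‖z‖) ^ p ≤ (B / ‖z‖) ^ p := by
          refine Real.rpow_le_rpow (div_nonneg (diffNorm_nonneg _) hz0.le) ?_ hp0.le
          gcongr
          exact diffNorm_le_two_mul hp hu.memLp z
        have hzp : 0 < ‖z‖ ^ p := Real.rpow_pos_of_pos hz0 p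
        have h2 : R ^ p ≤ ‖z‖ ^ p := Real.rpow_le_rpow hR.le hzR.le hp0.le
        refine h1.trans ?_
        rw [Real.div_rpow hB0 hz0.le]
        have h3 : B ^ p * 2 / R ^ p * (R ^ p / (R ^ p + ‖z‖ ^ p)) =
            B ^ p * 2 / (R ^ p + ‖z‖ ^ p) := by
          field_simp
        rw [h3, div_le_div_iff₀ hzp (by positivity)]
        have : 0 ≤ B ^ p := by positivity
        nlinarith
  have hR : ∀ R : ℝ, 0 < R → limsup (fun k => bbmEnergy p (κ k) u) atTop ≤
      L + ENNReal.ofReal (B ^ p * 2 / R ^ p) * (C + 1) := by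
    intro R hR
    have hlim := (ht.add (ENNReal.Tendsto.const_mul (a := ENNReal.ofReal (K ^ p))
      (hann 1 R one_pos) (Or.inr ENNReal.ofReal_ne_top))).add
      (tendsto_const_nhds (x := ENNReal.ofReal (B ^ p * 2 / R ^ p) * (C + 1)))
    rw [mul_zero, add_zero] at hlim
    rw [← hlim.limsup_eq]
    refine limsup_le_limsup ?_
    have hev := eventually_lt_of_limsup_lt ((htail R hR).trans_lt
      (ENNReal.lt_add_right hC one_ne_zero))
    filter_upwards [hev] with k hk
    rw [bbmEnergy_eq hp hu.memLp (hκ k)]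
    refine (lintegral_mono (hpt R hR)).trans ?_
    have hm1 : Measurable ((Metric.ball (0 : RN N) 1).indicator
        (fun z => ENNReal.ofReal (dirNormPow p u (direction e z)).toReal)) := by
      refine Measurable.indicator ?_ measurableSet_ball
      exact ((hu.continuous_toReal_dirNormPow hp).measurable.comp
        (measurable_subtype_coe.comp (measurable_direction e))).ennreal_ofReal
    have hm2 : Measurable ((annulus N 1 R).indicator
        (fun _ => ENNReal.ofReal (K ^ p))) :=
      measurable_const.indicator (isClosed_annulus 1 R).measurableSet
    have hm12 : Measurable fun z => (Metric.ball (0 : RN N) 1).indicator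
        (fun z => ENNReal.ofReal (dirNormPow p u (direction e z)).toReal) z +
        (annulus N 1 R).indicator (fun _ => ENNReal.ofReal (K ^ p)) z := hm1.add hm2
    rw [lintegral_add_left hm12, lintegral_add_left hm1,
      lintegral_indicator measurableSet_ball,
      lintegral_indicator_const (isClosed_annulus 1 R).measurableSet,
      lintegral_const_mul' _ _ ENNReal.ofReal_ne_top]
    gcongr
  have hlimR : Tendsto (fun R : ℝ => L + ENNReal.ofReal (B ^ p * 2 / R ^ p) * (C + 1)) atTop
      (𝓝 (L + ENNReal.ofReal 0 * (C + 1))) := by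
    refine tendsto_const_nhds.add (ENNReal.Tendsto.mul_const (ENNReal.tendsto_ofReal
      ((tendsto_rpow_atTop hp0).const_div_atTop _)) (Or.inr (by simp [hC])))
  rw [ENNReal.ofReal_zero, zero_mul, add_zero] at hlimR
  exact ge_of_tendsto hlimR ((eventually_gt_atTop 0).mono hR)

/-- Small differences of functions close to `u` are bounded from below by differences of `u` at a
fixed scale. -/
theorem rpow_le_diffNorm_div_rpow (hp : 1 ≤ p) (e : Sph N) {v : RN N → ℝ}
    (hu : MemLp u (ENNReal.ofReal p) volume) (hv : MemLp v (ENNReal.ofReal p) volume) {K : ℝ}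
    (hK : 0 ≤ K) (hKu : ∀ z : RN N, diffNorm p u z ≤ K * ‖z‖) {δ η : ℝ} (hηδ : η ≤ δ)
    (hvu : 2 * (eLpNorm (v - u) (ENNReal.ofReal p) volume).toReal ≤ η) {z : RN N} (hz : z ≠ 0)
    (hzη : ‖z‖ < η) :
    (max 0 (diffNorm p u (δ • (direction e z : RN N)) - (K + 1) * η) / δ) ^ p ≤
      (diffNorm p v z / ‖z‖) ^ p := by
  have hp0 : 0 < p := by linarith
  have hz0 : 0 < ‖z‖ := norm_pos_iff.2 hz
  have hδ : 0 < δ := by linarith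
  set σ : RN N := (direction e z : RN N) with hσ
  have hσ1 : ‖σ‖ = 1 := norm_eq_of_mem_sphere _
  have hzσ : ‖z‖ • σ = z := norm_smul_direction e hz
  refine Real.rpow_le_rpow (by positivity) ?_ hp0.le
  -- The point `n • z` falls short of `δ • σ` by less than `‖z‖ < η`, costing `K * η`; exchanging
  -- `u` for `v` costs another `η`.
  set n := ⌊δ / ‖z‖⌋₊ with hn
  have hn1 : (n : ℝ) * ‖z‖ ≤ δ := by
    have := Nat.floor_le (div_nonneg hδ.le hz0.le)
    exact (le_div_iff₀ hz0).1 this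
  have hn2 : δ < (n + 1) * ‖z‖ := (div_lt_iff₀ hz0).1 (Nat.lt_floor_add_one (δ / ‖z‖))
  have hnpos : (0 : ℝ) < n := by
    have : 0 < n := Nat.floor_pos.2 ((one_le_div hz0).2 (by linarith))
    exact_mod_cast this
  have h1 : diffNorm p u (δ • σ) ≤ diffNorm p u (n • z) + K * η := by
    have e1 : δ • σ = n • z + (δ - n * ‖z‖) • σ := by
      have hnz : (n : ℝ) • z = ((n : ℝ) * ‖z‖) • σ := by rw [mul_smul, hzσ]
      rw [← Nat.cast_smul_eq_nsmul ℝ, hnz, ← add_smul]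
      congr 1
      ring
    rw [e1]
    refine (diffNorm_add_le hp hu _ _).trans ?_
    gcongr
    refine (hKu _).trans ?_
    rw [norm_smul, hσ1, mul_one, Real.norm_eq_abs, abs_of_nonneg (by linarith)]
    gcongr
    linarith
  have h2 : diffNorm p u (n • z) ≤ diffNorm p v (n • z) + η :=
    (diffNorm_le_add hp hu hv _).trans (by gcongr)
  have h3 := diffNorm_nsmul_le hp hv n z
  have hη0 : 0 < η := hz0.trans hzη
  have h4 : diffNorm p u (δ • σ) - (K + 1) * η ≤ n * diffNorm p v z := by linarith
  have h5 : max 0 (diffNorm p u (δ • σ) - (K + 1) * η) ≤ n * diffNorm p v z :=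
    max_le (mul_nonneg hnpos.le (diffNorm_nonneg _)) h4
  rw [div_le_div_iff₀ hδ hz0]
  calc max 0 (diffNorm p u (δ • σ) - (K + 1) * η) * ‖z‖ ≤ n * diffNorm p v z * ‖z‖ := by gcongr
    _ = diffNorm p v z * (n * ‖z‖) := by ring
    _ ≤ diffNorm p v z * δ := by
      gcongr
      exact diffNorm_nonneg z

/-- The norm of the directional derivative is the limit of difference quotients along a dyadic
sequence of scales. -/
theorem MemS.dirNormPow_le_liminf (hp : 1 ≤ p) (hu : MemS p u) {K : ℝ}
    (hKu : ∀ z : RN N, diffNorm p u z ≤ K * ‖z‖) {σ : RN N} (hσ : ‖σ‖ = 1) :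
    dirNormPow p u σ ≤ liminf (fun j : ℕ => ENNReal.ofReal
      ((max 0 (diffNorm p u ((1 / 2 : ℝ) ^ (j + 1) • σ) -
        (K + 1) * ((1 / 2 : ℝ) ^ (j + 1)) ^ 2) / (1 / 2 : ℝ) ^ (j + 1)) ^ p)) atTop := by
  have hp0 : 0 < p := by linarith
  set δ : ℕ → ℝ := fun j => (1 / 2 : ℝ) ^ (j + 1) with hδdef
  have hδ : ∀ j, 0 < δ j := fun j => by positivity
  have hδt : Tendsto δ atTop (𝓝 0) :=
    (tendsto_pow_atTop_nhds_zero_of_lt_one (by norm_num) (by norm_num)).comp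
      (tendsto_add_atTop_nat 1)
  set q : ℕ → ℝ := fun j => diffNorm p u (δ j • σ) / δ j with hq
  have hqK : ∀ j, q j ≤ K := fun j => by
    rw [hq, div_le_iff₀ (hδ j)]
    have := hKu (δ j • σ)
    rwa [norm_smul, hσ, mul_one, Real.norm_eq_abs, abs_of_pos (hδ j)] at this
  have hq0 : ∀ j, 0 ≤ q j := fun j => div_nonneg (diffNorm_nonneg _) (hδ j).le
  -- Halving the step cannot decrease the quotient, by subadditivity, so the dyadic quotients
  -- converge to their supremum.
  have hmono : Monotone q := by
    refine monotone_nat_of_le_succ fun j => ?_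
    have e1 : δ j = 2 * δ (j + 1) := by rw [hδdef]; ring
    have h1 := diffNorm_nsmul_le hp hu.memLp 2 (δ (j + 1) • σ)
    rw [← Nat.cast_smul_eq_nsmul ℝ, smul_smul, Nat.cast_ofNat, ← e1] at h1
    rw [hq, div_le_div_iff₀ (hδ j) (hδ (j + 1))]
    have := hδ (j + 1)
    calc diffNorm p u (δ j • σ) * δ (j + 1) ≤ 2 * diffNorm p u (δ (j + 1) • σ) * δ (j + 1) := by
          gcongr
      _ = diffNorm p u (δ (j + 1) • σ) * δ j := by rw [e1]; ring
  have hbdd : BddAbove (range q) := ⟨K, by rintro _ ⟨j, rfl⟩; exact hqK j⟩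
  have hqt := tendsto_atTop_ciSup hmono hbdd
  set M := ⨆ j, q j with hM
  have hM0 : 0 ≤ M := (hq0 0).trans (le_ciSup hbdd 0)
  have hA : dirNormPow p u σ ≤ ENNReal.ofReal (M ^ p) := by
    refine hu.dirNormPow_le hp hM0 fun s hs => ?_
    -- Any step `s` is an integer multiple of `δ j` plus a remainder below `δ j`, whose cost
    -- disappears as `j → ∞`.
    have hj : ∀ j, diffNorm p u (s • σ) ≤ s * M + K * δ j := by
      intro j
      set n := ⌊s / δ j⌋₊ with hn
      have hn1 : (n : ℝ) * δ j ≤ s :=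
        (le_div_iff₀ (hδ j)).1 (Nat.floor_le (div_nonneg hs.le (hδ j).le))
      have hn2 : s < (n + 1) * δ j := (div_lt_iff₀ (hδ j)).1 (Nat.lt_floor_add_one (s / δ j))
      have e1 : s • σ = n • (δ j • σ) + (s - n * δ j) • σ := by
        rw [← Nat.cast_smul_eq_nsmul ℝ, smul_smul, ← add_smul]
        congr 1
        ring
      have h1 : diffNorm p u ((s - n * δ j) • σ) ≤ K * δ j := by
        refine (hKu _).trans ?_
        rw [norm_smul, hσ, mul_one, Real.norm_eq_abs, abs_of_nonneg (by linarith)]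
        have : 0 ≤ K := (hq0 0).trans (hqK 0)
        gcongr
        linarith
      have h2 : diffNorm p u (n • (δ j • σ)) ≤ s * M := by
        refine (diffNorm_nsmul_le hp hu.memLp n _).trans ?_
        have e2 : diffNorm p u (δ j • σ) = q j * δ j := by
          rw [hq]; exact (div_mul_cancel₀ _ (hδ j).ne').symm
        rw [e2]
        calc (n : ℝ) * (q j * δ j) = (n * δ j) * q j := by ring
          _ ≤ s * M := mul_le_mul hn1 (le_ciSup hbdd j) (hq0 j) hs.le
      rw [e1]
      exact (diffNorm_add_le hp hu.memLp _ _).trans (add_le_add h2 h1)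
    have hlim := (hδt.const_mul K).const_add (s * M)
    rw [mul_zero, add_zero] at hlim
    exact ge_of_tendsto' hlim hj
  refine hA.trans (le_of_eq (Tendsto.liminf_eq ?_).symm)
  refine ENNReal.tendsto_ofReal (Tendsto.rpow_const ?_ (Or.inr hp0.le))
  have e1 : ∀ j, max 0 (diffNorm p u (δ j • σ) - (K + 1) * δ j ^ 2) / δ j =
      max 0 (q j - (K + 1) * δ j) := by
    intro j
    have h := hδ j
    rw [← max_div_div_right h.le, zero_div]
    congr 1
    rw [hq]
    field_simp
  have hlim : Tendsto (fun j => max 0 (q j - (K + 1) * δ j)) atTop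
      (𝓝 (max 0 (M - (K + 1) * 0))) :=
    tendsto_const_nhds.max (hqt.sub (hδt.const_mul (K + 1)))
  rw [mul_zero, sub_zero, max_eq_right hM0] at hlim
  exact hlim.congr fun j => (e1 j).symm

/-- At a fixed scale the lower bound is a continuous function of the direction of `z` alone, so it
passes to the limit in `k` against `μ`. Fatou's lemma over the dyadic scales then recovers the
directional norm. -/
theorem dirichletEnergy_le_liminf_bbmEnergy (hN : 0 < N) (hp : 1 ≤ p) (e : Sph N)
    {κ : ℕ → RN N → ℝ} (hκ : ∀ k, AEMeasurable (κ k) volume)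
    (hann : ∀ r M : ℝ, 0 < r →
      Tendsto (fun k => kernelMeasure (κ k) (annulus N r M)) atTop (𝓝 0))
    {μ : Measure (Sph N)}
    (ht : ∀ g : Sph N → ℝ, Continuous g → Tendsto (fun k => ∫⁻ z in Metric.ball 0 1,
      ENNReal.ofReal (g (direction e z)) ∂(kernelMeasure (κ k))) atTop
      (𝓝 (∫⁻ σ, ENNReal.ofReal (g σ) ∂μ)))
    {v : ℕ → RN N → ℝ} (hv : ∀ k, MemLp (v k) (ENNReal.ofReal p) volume) (hu : MemS p u)
    (hvu : Tendsto (fun k => eLpNorm (v k - u) (ENNReal.ofReal p) volume) atTop (𝓝 0)) :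
    dirichletEnergy p μ u ≤ liminf (fun k => bbmEnergy p (κ k) (v k)) atTop := by
  have hp0 : 0 < p := by linarith
  obtain ⟨K, hK, hKu⟩ := hu.exists_diffNorm_le hp
  have hdc := continuous_diffNorm hp hu.memLp hK hKu
  set G : ℕ → Sph N → ℝ := fun j σ =>
    (max 0 (diffNorm p u ((1 / 2 : ℝ) ^ (j + 1) • (σ : RN N)) -
      (K + 1) * ((1 / 2 : ℝ) ^ (j + 1)) ^ 2) / (1 / 2 : ℝ) ^ (j + 1)) ^ p with hG
  have hGc : ∀ j, Continuous (G j) := by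
    intro j
    refine Continuous.rpow_const ?_ fun _ => Or.inr hp0.le
    refine Continuous.div_const (continuous_const.max (Continuous.sub ?_ continuous_const)) _
    have hsc : Continuous fun σ : Sph N => (1 / 2 : ℝ) ^ (j + 1) • (σ : RN N) := by fun_prop
    exact hdc.comp hsc
  have hstep : ∀ j, ∫⁻ σ, ENNReal.ofReal (G j σ) ∂μ ≤
      liminf (fun k => bbmEnergy p (κ k) (v k)) atTop := by
    intro j
    set δ : ℝ := (1 / 2 : ℝ) ^ (j + 1) with hδdef
    have hδ : 0 < δ := by positivity
    have hδ1 : δ ≤ 1 := pow_le_one₀ (by norm_num) (by norm_num)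
    -- With `η = δ ^ 2` the error `(K + 1) * η / δ` tends to zero with `δ`.
    refine (le_liminf_lintegral_direction e hann (hGc j) (ht _ (hGc j)) (η := δ ^ 2)
      (by positivity)).trans (liminf_le_liminf ?_)
    have hsmall : Tendsto (fun k => 2 * (eLpNorm (v k - u) (ENNReal.ofReal p) volume).toReal)
        atTop (𝓝 (2 * 0)) :=
      ((ENNReal.tendsto_toReal ENNReal.zero_ne_top).comp hvu).const_mul 2
    rw [mul_zero] at hsmall
    filter_upwards [hsmall.eventually (ge_mem_nhds (by positivity : 0 < δ ^ 2))] with k hk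
    rw [bbmEnergy_eq hp (hv k) (hκ k), ← lintegral_indicator measurableSet_ball]
    refine lintegral_mono_ae ?_
    filter_upwards [ae_ne_zero_kernelMeasure (κ := κ k) hN] with z hz
    by_cases hzb : z ∈ Metric.ball (0 : RN N) (δ ^ 2)
    · rw [indicator_of_mem hzb]
      rw [mem_ball_zero_iff] at hzb
      exact ENNReal.ofReal_le_ofReal (rpow_le_diffNorm_div_rpow hp e hu.memLp (hv k) hK hKu
        (by nlinarith) hk hz hzb)
    · rw [indicator_of_notMem hzb]
      exact zero_le
  calc dirichletEnergy p μ u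
      ≤ ∫⁻ σ, liminf (fun j => ENNReal.ofReal (G j σ)) atTop ∂μ :=
        lintegral_mono fun σ => hu.dirNormPow_le_liminf hp hKu (norm_eq_of_mem_sphere σ)
    _ ≤ liminf (fun j => ∫⁻ σ, ENNReal.ofReal (G j σ) ∂μ) atTop :=
        lintegral_liminf_le fun j => (hGc j).measurable.ennreal_ofReal
    _ ≤ liminf (fun _ : ℕ => liminf (fun k => bbmEnergy p (κ k) (v k)) atTop) atTop :=
        liminf_le_liminf (Eventually.of_forall hstep)
    _ = _ := liminf_const _

/-- The subsequence and `μ` are fixed before any function is chosen: weak convergence holds against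
all continuous functions on the sphere simultaneously. -/
theorem exists_subseq_energy_convergence (hN : 0 < N) (hp : 1 ≤ p) {κ : ℕ → RN N → ℝ}
    (hκ : ∀ k, LocallyIntegrable (κ k) volume)
    (htail : (⨆ (R : ℝ) (_ : 0 < R), limsup (fun k => ENNReal.ofReal (R ^ p) *
      ∫⁻ z, ENNReal.ofReal (κ k z / (R ^ p + ‖z‖ ^ p))) atTop) < ⊤) {α : ℝ≥0}
    (hα : WeakStarTendsto (fun k => kernelMeasure (κ k)) (α • Measure.dirac 0)) :
    ∃ φ : ℕ → ℕ, StrictMono φ ∧ ∃ μ : Measure (Sph N), IsFiniteMeasure μ ∧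
      (∀ u : RN N → ℝ, MemS p u →
        limsup (fun k => bbmEnergy p (κ (φ k)) u) atTop ≤ dirichletEnergy p μ u) ∧
      (∀ (v : ℕ → RN N → ℝ) (u : RN N → ℝ), (∀ k, MemLp (v k) (ENNReal.ofReal p) volume) →
        MemS p u →
        Tendsto (fun k => eLpNorm (v k - u) (ENNReal.ofReal p) volume) atTop (𝓝 0) →
        dirichletEnergy p μ u ≤ liminf (fun k => bbmEnergy p (κ (φ k)) (v k)) atTop) := by
  have hκm : ∀ k, AEMeasurable (κ k) volume := fun k => (hκ k).aestronglyMeasurable.aemeasurable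
  have hfin : ∀ k, IsFiniteMeasureOnCompacts (kernelMeasure (κ k)) := fun k =>
    isFiniteMeasureOnCompacts_kernelMeasure (hκ k)
  obtain ⟨e⟩ : Nonempty (Sph N) := ⟨⟨EuclideanSpace.single ⟨0, hN⟩ 1, by simp⟩⟩
  obtain ⟨φ, hφ, μ, hμ, ht⟩ := exists_subseq_tendsto_direction e hfin (hα.tendsto_ball hfin)
  have hann : ∀ r M : ℝ, 0 < r →
      Tendsto (fun k => kernelMeasure (κ (φ k)) (annulus N r M)) atTop (𝓝 0) :=
    fun r M hr => (hα.tendsto_annulus hfin hr M).comp hφ.tendsto_atTop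
  refine ⟨φ, hφ, μ, hμ, fun u hu => ?_, fun v u hv hu hvu =>
    dirichletEnergy_le_liminf_bbmEnergy hN hp e (fun k => hκm _) hann ht hv hu hvu⟩
  have hlim := ht (fun σ => (dirNormPow p u (σ : RN N)).toReal)
    ((hu.continuous_toReal_dirNormPow hp).comp continuous_subtype_val)
  have hE : ∫⁻ σ : Sph N, ENNReal.ofReal (dirNormPow p u (σ : RN N)).toReal ∂μ =
      dirichletEnergy p μ u :=
    lintegral_congr fun σ => ENNReal.ofReal_toReal (hu.dirNormPow_lt_top _).ne
  rw [hE] at hlim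
  refine limsup_bbmEnergy_le hp e (fun k => hκm _) hann htail.ne (fun R hR => ?_) hu hlim
  refine le_trans ?_ (le_iSup₂_of_le R hR le_rfl)
  have hrw : (fun k => ENNReal.ofReal (R ^ p) *
      ∫⁻ z, ENNReal.ofReal (κ k z / (R ^ p + ‖z‖ ^ p))) = fun k =>
      ∫⁻ z, ENNReal.ofReal (R ^ p / (R ^ p + ‖z‖ ^ p)) ∂(kernelMeasure (κ k)) :=
    funext fun k => ofReal_rpow_mul_lintegral_kernel (hκm k) p hR
  rw [hrw]
  exact Tendsto.limsup_comp_le_limsup (v := φ) (u := fun k =>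
    ∫⁻ z, ENNReal.ofReal (R ^ p / (R ^ p + ‖z‖ ^ p)) ∂(kernelMeasure (κ k))) hφ.tendsto_atTop

end Sufficiency

/-! ### The equivalence -/

theorem IsInfinitesimal.comp {t : ℕ → ℝ} (ht : IsInfinitesimal t) {φ : ℕ → ℕ}
    (hφ : StrictMono φ) : IsInfinitesimal (t ∘ φ) :=
  ⟨fun k => ht.1 (φ k), ht.2.comp hφ.tendsto_atTop⟩

end

theorem theorem1p1 (N : ℕ) (hN : 0 < N) (p : ℝ) (hp : 1 ≤ p) (ρ : ℝ → RN N → ℝ)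
    (hρ_loc : ∀ t ∈ Ioo (0 : ℝ) 1, LocallyIntegrable (ρ t) volume)
    (hρ_nonneg : ∀ t ∈ Ioo (0 : ℝ) 1, ∀ᵐ z, 0 ≤ ρ t z) :
    (∃ t : ℕ → ℝ, IsInfinitesimal t ∧
      (⨆ (R : ℝ) (_ : 0 < R), limsup (fun k => ENNReal.ofReal (R ^ p) *
        ∫⁻ z, ENNReal.ofReal (ρ (t k) z / (R ^ p + ‖z‖ ^ p))) atTop) < ⊤ ∧
      ∃ α : ℝ≥0, WeakStarTendsto (fun k => kernelMeasure (ρ (t k))) (α • Measure.dirac 0)) ↔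
    (∃ t : ℕ → ℝ, IsInfinitesimal t ∧ ∃ μ : Measure (Sph N), IsFiniteMeasure μ ∧
      (∀ u : RN N → ℝ, MemS p u →
        limsup (fun k => bbmEnergy p (ρ (t k)) u) atTop ≤ dirichletEnergy p μ u) ∧
      (∀ (v : ℕ → RN N → ℝ) (u : RN N → ℝ), (∀ k, MemLp (v k) (ENNReal.ofReal p) volume) →
        MemS p u →
        Tendsto (fun k => eLpNorm (v k - u) (ENNReal.ofReal p) volume) atTop (𝓝 0) →
        dirichletEnergy p μ u ≤ liminf (fun k => bbmEnergy p (ρ (t k)) (v k)) atTop)) := by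
  constructor
  · rintro ⟨t, ht, htail, α, hα⟩
    obtain ⟨φ, hφ, h⟩ := exists_subseq_energy_convergence hN hp
      (fun k => hρ_loc (t k) (ht.1 k)) htail hα
    exact ⟨t ∘ φ, ht.comp hφ, h⟩
  · rintro ⟨t, ht, μ, hμ, hsup, hinf⟩
    -- The lower bound is needed only along constant sequences.
    obtain ⟨φ, hφ, h⟩ := exists_subseq_of_energy_convergence hN hp
      (fun k => hρ_loc (t k) (ht.1 k)) hsup
      (fun u hu => hinf (fun _ => u) u (fun _ => hu.memLp) hu (by simp))
    exact ⟨t ∘ φ, ht.comp hφ, h⟩
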